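/- Let $n\ge 2$ be an integer, let $\mathcal D\subset\{0,1,\dots,n-1\}^2$ with $1<\#\mathcal D<n^2$, and let $F\subset\mathbb R^2$ be the fractal square determined by $n$ and $\mathcal D$, i.e. the unique non-empty compact set with $F=(F+\mathcal D)/n$. Put $H=F+\mathbb Z^2$ and $H^c=\mathbb R^2\setminus H$. "Component" means connected component, and a component is called non-trivial if it has more than one point. Then exactly one of the following two cases occurs. (i) $H^c$ has a bounded component. This happens if and only if $F$ has a non-trivial component that is not a line segment. (ii) $H^c$ has an unbounded component. In this case either $F$ is totally disconnected, or $F$ has non-trivial components and all of them are line segments parallel to one common direction; in the latter situation $H^c$ has infinitely many unbounded components. -/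

import Mathlib

namespace FractalSquare

/-- `F` is the fractal square with ratio `1 / n` and digit set `D`: the (unique) non-empty compact
subset of the plane with `F = (F + D) / n`. The plane is `ℝ × ℝ`; only its topology, its bounded
sets and its linear structure are used, and these do not depend on the choice of a norm. -/
structure IsFractalSquare (n : ℕ) (D : Finset (ℕ × ℕ)) (F : Set (ℝ × ℝ)) : Prop where
  isCompact : IsCompact F
  nonempty : F.Nonempty
  eq : F = {y | ∃ x ∈ F, ∃ d ∈ D, y = (n : ℝ)⁻¹ • (x + ((d.1 : ℝ), (d.2 : ℝ)))}

/-- The periodic extension `F + ℤ²`. -/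
def periodicExtension (F : Set (ℝ × ℝ)) : Set (ℝ × ℝ) :=
  {y | ∃ x ∈ F, ∃ z : ℤ × ℤ, y = x + ((z.1 : ℝ), (z.2 : ℝ))}

/-- `C` is a connected component of the set `S` (with the subspace topology). -/
def IsComponent (C S : Set (ℝ × ℝ)) : Prop :=
  ∃ x ∈ S, C = connectedComponentIn S x

/-- `C` is a (non-degenerate) line segment. -/
def IsLineSegment (C : Set (ℝ × ℝ)) : Prop :=
  ∃ a b : ℝ × ℝ, a ≠ b ∧ C = segment ℝ a b

/-- All components of `S` with more than one point are line segments, parallel to a common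
direction `v`. -/
def NontrivialComponentsParallelSegments (S : Set (ℝ × ℝ)) : Prop :=
  ∃ v : ℝ × ℝ, v ≠ 0 ∧ ∀ C : Set (ℝ × ℝ), IsComponent C S → C.Nontrivial →
    ∃ a : ℝ × ℝ, ∃ t : ℝ, 0 < t ∧ C = segment ℝ a (a + t • v)

end FractalSquare

open Set Filter Topology

namespace FractalSquare

open scoped unitInterval

/-! ### Integer translations, digit expansions and invariance of `F + ℤ²` under expansion. -/

variable {n : ℕ} {D : Finset (ℕ × ℕ)} {F : Set (ℝ × ℝ)}

/-! Write `H = F + ℤ²`. This set is closed, `ℤ²`-periodic, and `n • H ⊆ H`. The pivot between the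
two cases is whether all connected subsets of `F` lie in lines of one common direction (`IsLinear`).

An unbounded component of `Hᶜ` makes `F` linear. By `exists_loop`, `Hᶜ` contains a curve from some
`x` to `x + v` with `v ≠ 0` integral. Otherwise each component of `Hᶜ` would meet the removed cells
in a set of uniformly bounded diameter, so a long curve in `Hᶜ` would contain a long arc missing
these cells. Such an arc may be expanded by `n` inside `Hᶜ` and trimmed again. Repeating this
forever produces a point of the curve that is never removed, hence in `H`. Given the curve, a
winding number argument on the cylinder (`not_crossing`) bounds the width transversal to `v` of all
connected subsets of `H`. As `n ^ k • C ⊆ H` for every connected `C ⊆ F`, that width vanishes on `F`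
(`cross_eq_zero_of_loop`).

A linear `F` excludes bounded components of `Hᶜ`. Linearity passes from `F` to every continuum in
`H` by boundary bumping and Baire (`cross_eq_zero_of_continuum`), whereas the frontier of a bounded
component contains a continuum lying in no line (`exists_continuum_of_bounded_component`). So the
cases exclude each other.

If all non-trivial components of `F` are segments but `F` is not linear, two non-parallel segments
blow up to two non-parallel lines in `H` (`exists_line`). Their crossing yields two non-parallel
segments of `F` with a common endpoint (`hasCorner_of_lines`), a contradiction. Finally, when `F` is
linear and contains a segment, the integer translates of a line in `H` separate infinitely many
translates of an unbounded component. -/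

/-- The point of the plane with the given integer coordinates. -/
def latticePoint (z : ℤ × ℤ) : ℝ × ℝ := ((z.1 : ℝ), (z.2 : ℝ))

@[simp] lemma latticePoint_fst (z : ℤ × ℤ) : (latticePoint z).1 = z.1 := rfl
@[simp] lemma latticePoint_snd (z : ℤ × ℤ) : (latticePoint z).2 = z.2 := rfl

lemma latticePoint_add (z w : ℤ × ℤ) : latticePoint (z + w) = latticePoint z + latticePoint w := by
  ext <;> simp

lemma latticePoint_neg (z : ℤ × ℤ) : latticePoint (-z) = -latticePoint z := by
  ext <;> simp

lemma latticePoint_sub (z w : ℤ × ℤ) : latticePoint (z - w) = latticePoint z - latticePoint w := by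
  ext <;> simp

lemma latticePoint_zsmul (k : ℤ) (z : ℤ × ℤ) : latticePoint (k • z) = (k : ℝ) • latticePoint z := by
  ext <;> simp

@[simp] lemma latticePoint_zero : latticePoint 0 = 0 := by
  ext <;> simp

lemma latticePoint_injective : Function.Injective latticePoint := by
  intro z w h
  have h1 := congrArg Prod.fst h
  have h2 := congrArg Prod.snd h
  simp only [latticePoint_fst, latticePoint_snd, Int.cast_inj] at h1 h2
  exact Prod.ext h1 h2

/-- The coordinatewise integer part. -/
noncomputable def floorPoint (x : ℝ × ℝ) : ℤ × ℤ := (⌊x.1⌋, ⌊x.2⌋)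

lemma mem_periodicExtension {F : Set (ℝ × ℝ)} {y : ℝ × ℝ} :
    y ∈ periodicExtension F ↔ ∃ z : ℤ × ℤ, y - latticePoint z ∈ F := by
  constructor
  · rintro ⟨x, hx, z, rfl⟩
    exact ⟨z, by simpa [latticePoint] using hx⟩
  · rintro ⟨z, hz⟩
    exact ⟨_, hz, z, by simp [latticePoint]⟩

lemma add_latticePoint_mem {F : Set (ℝ × ℝ)} {y : ℝ × ℝ} (z : ℤ × ℤ) :
    y + latticePoint z ∈ periodicExtension F ↔ y ∈ periodicExtension F := by
  simp only [mem_periodicExtension]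
  constructor
  · rintro ⟨w, hw⟩
    refine ⟨w - z, ?_⟩
    rw [latticePoint_sub]
    convert hw using 1; abel
  · rintro ⟨w, hw⟩
    refine ⟨w + z, ?_⟩
    rw [latticePoint_add]
    convert hw using 1; abel

lemma sub_latticePoint_mem {F : Set (ℝ × ℝ)} {y : ℝ × ℝ} (z : ℤ × ℤ) :
    y - latticePoint z ∈ periodicExtension F ↔ y ∈ periodicExtension F := by
  rw [sub_eq_add_neg, ← latticePoint_neg, add_latticePoint_mem]

lemma subset_periodicExtension (F : Set (ℝ × ℝ)) : F ⊆ periodicExtension F := fun x hx =>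
  mem_periodicExtension.2 ⟨0, by simpa using hx⟩

lemma isClosed_range_latticePoint : IsClosed (range latticePoint) := by
  have := (Int.isClosedEmbedding_coe_real.isClosed_range).prod
    (Int.isClosedEmbedding_coe_real.isClosed_range)
  convert this using 1
  ext ⟨a, b⟩
  simp [latticePoint]

lemma isClosed_periodicExtension {F : Set (ℝ × ℝ)} (hF : IsCompact F) :
    IsClosed (periodicExtension F) := by
  have := isClosed_range_latticePoint.add_left_of_isCompact hF
  convert this using 1
  ext y
  rw [mem_periodicExtension, Set.mem_add]
  constructor
  · rintro ⟨z, hz⟩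
    exact ⟨_, hz, _, ⟨z, rfl⟩, by simp⟩
  · rintro ⟨x, hx, _, ⟨z, rfl⟩, rfl⟩
    exact ⟨z, by simpa using hx⟩

lemma IsFractalSquare.exists_digit (hn : n ≠ 0) (hF : IsFractalSquare n D F) {x : ℝ × ℝ}
    (hx : x ∈ F) : ∃ d ∈ D, (n : ℝ) • x - ((d.1 : ℝ), (d.2 : ℝ)) ∈ F := by
  rw [hF.eq] at hx
  obtain ⟨y, hy, d, hd, rfl⟩ := hx
  refine ⟨d, hd, ?_⟩
  rw [smul_smul, mul_inv_cancel₀ (by positivity), one_smul]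
  simpa using hy

lemma IsFractalSquare.contract_mem (hF : IsFractalSquare n D F) {x : ℝ × ℝ}
    (hx : x ∈ F) {d : ℕ × ℕ} (hd : d ∈ D) :
    (n : ℝ)⁻¹ • (x + ((d.1 : ℝ), (d.2 : ℝ))) ∈ F := by
  rw [hF.eq]
  exact ⟨x, hx, d, hd, rfl⟩

/-- Extremum principle: at a minimum `m` of `f`, `n * f m ≥ f m`; at a maximum, `n * f m ≤ f m + n -
1`. It is applied to the two coordinates. -/
lemma nonneg_le_one_of_digits (hn : 2 ≤ n) (hF : IsCompact F) (f : ℝ × ℝ → ℝ) (hf : Continuous f)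
    (h : ∀ x ∈ F, ∃ y ∈ F, ∃ d : ℕ, d < n ∧ (n : ℝ) * f x = f y + d) {x : ℝ × ℝ} (hx : x ∈ F) :
    0 ≤ f x ∧ f x ≤ 1 := by
  have hn' : (2 : ℝ) ≤ n := by exact_mod_cast hn
  constructor
  · obtain ⟨m, hm, hmin⟩ := hF.exists_isMinOn ⟨x, hx⟩ hf.continuousOn
    obtain ⟨y, hy, d, -, hd⟩ := h m hm
    have h1 : f m ≤ f y := hmin hy
    have h2 : f m ≤ f x := hmin hx
    have : (0 : ℝ) ≤ d := by positivity
    nlinarith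
  · obtain ⟨m, hm, hmax⟩ := hF.exists_isMaxOn ⟨x, hx⟩ hf.continuousOn
    obtain ⟨y, hy, d, hdn, hd⟩ := h m hm
    have h1 : f y ≤ f m := hmax hy
    have h2 : f x ≤ f m := hmax hx
    have : (d : ℝ) + 1 ≤ n := by exact_mod_cast hdn
    nlinarith

lemma IsFractalSquare.mem_unit (hn : 2 ≤ n) (hD : ∀ d ∈ D, d.1 < n ∧ d.2 < n)
    (hF : IsFractalSquare n D F) {x : ℝ × ℝ} (hx : x ∈ F) :
    (0 ≤ x.1 ∧ x.1 ≤ 1) ∧ (0 ≤ x.2 ∧ x.2 ≤ 1) := by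
  refine ⟨nonneg_le_one_of_digits hn hF.isCompact _ continuous_fst (fun x hx => ?_) hx,
    nonneg_le_one_of_digits hn hF.isCompact _ continuous_snd (fun x hx => ?_) hx⟩ <;>
  obtain ⟨d, hd, h⟩ := hF.exists_digit (by omega) hx
  · exact ⟨_, h, d.1, (hD d hd).1, by simp⟩
  · exact ⟨_, h, d.2, (hD d hd).2, by simp⟩

lemma IsFractalSquare.exists_digit_pow (hn : 2 ≤ n) (hD : ∀ d ∈ D, d.1 < n ∧ d.2 < n)
    (hF : IsFractalSquare n D F) (k : ℕ) {x : ℝ × ℝ} (hx : x ∈ F) :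
    ∃ w : ℤ × ℤ, (0 ≤ w.1 ∧ w.1 < (n : ℤ) ^ k) ∧ (0 ≤ w.2 ∧ w.2 < (n : ℤ) ^ k) ∧
      (n : ℝ) ^ k • x - latticePoint w ∈ F := by
  induction k with
  | zero => exact ⟨0, by simp, by simp, by simpa using hx⟩
  | succ k ih =>
    obtain ⟨w, h1, h2, hw⟩ := ih
    obtain ⟨d, hd, h⟩ := hF.exists_digit (by omega) hw
    have hd' := hD d hd
    have e1 : (d.1 : ℤ) + 1 ≤ n := by exact_mod_cast hd'.1
    have e2 : (d.2 : ℤ) + 1 ≤ n := by exact_mod_cast hd'.2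
    have hn0 : (0 : ℤ) ≤ n := by positivity
    refine ⟨(n * w.1 + d.1, n * w.2 + d.2), ⟨?_, ?_⟩, ⟨?_, ?_⟩, ?_⟩
    · have := mul_nonneg hn0 h1.1
      dsimp only; positivity
    · have : (n : ℤ) * (w.1 + 1) ≤ n * n ^ k := mul_le_mul_of_nonneg_left h1.2 hn0
      dsimp only; rw [pow_succ']; linarith
    · have := mul_nonneg hn0 h2.1
      dsimp only; positivity
    · have : (n : ℤ) * (w.2 + 1) ≤ n * n ^ k := mul_le_mul_of_nonneg_left h2.2 hn0
      dsimp only; rw [pow_succ']; linarith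
    · convert h using 1
      ext
      · simp; ring
      · simp; ring

lemma IsFractalSquare.smul_mem (hn : n ≠ 0) (hF : IsFractalSquare n D F) {x : ℝ × ℝ}
    (hx : x ∈ periodicExtension F) : (n : ℝ) • x ∈ periodicExtension F := by
  obtain ⟨z, hz⟩ := mem_periodicExtension.1 hx
  obtain ⟨d, hd, h⟩ := hF.exists_digit hn hz
  refine mem_periodicExtension.2 ⟨(n * z.1 + d.1, n * z.2 + d.2), ?_⟩
  convert h using 1
  ext
  · simp; ring
  · simp; ring

lemma IsFractalSquare.pow_smul_mem (hn : n ≠ 0) (hF : IsFractalSquare n D F) (k : ℕ) {x : ℝ × ℝ}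
    (hx : x ∈ periodicExtension F) : (n : ℝ) ^ k • x ∈ periodicExtension F := by
  induction k with
  | zero => simpa using hx
  | succ k ih => rw [pow_succ', mul_smul]; exact hF.smul_mem hn ih

/-! ### Unit cells, and the small cells removed at the first step. -/

lemma eq_of_mem_cell {a b : ℤ} {x : ℝ} (h1 : (a : ℝ) < x) (h2 : x < a + 1) (h3 : (b : ℝ) ≤ x)
    (h4 : x ≤ b + 1) : a = b := by
  have h5 : (a : ℝ) < ((b + 1 : ℤ) : ℝ) := by push_cast; linarith
  have h6 : (b : ℝ) < ((a + 1 : ℤ) : ℝ) := by push_cast; linarith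
  rw [Int.cast_lt] at h5 h6
  omega

/-- The open unit cell with lower left corner `z`. -/
def openCell (z : ℤ × ℤ) : Set (ℝ × ℝ) :=
  Ioo (z.1 : ℝ) (z.1 + 1) ×ˢ Ioo (z.2 : ℝ) (z.2 + 1)

/-- The closed unit cell with lower left corner `z`. -/
def closedCell (z : ℤ × ℤ) : Set (ℝ × ℝ) :=
  Icc (z.1 : ℝ) (z.1 + 1) ×ˢ Icc (z.2 : ℝ) (z.2 + 1)

lemma isOpen_openCell (z : ℤ × ℤ) : IsOpen (openCell z) := isOpen_Ioo.prod isOpen_Ioo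

lemma closure_openCell (z : ℤ × ℤ) : closure (openCell z) = closedCell z := by
  rw [openCell, closure_prod_eq, closure_Ioo (by simp), closure_Ioo (by simp), closedCell]

lemma eq_of_mem_openCell {z w : ℤ × ℤ} {x : ℝ × ℝ} (h : x ∈ openCell z) (h' : x ∈ closedCell w) :
    z = w :=
  Prod.ext (eq_of_mem_cell h.1.1 h.1.2 h'.1.1 h'.1.2) (eq_of_mem_cell h.2.1 h.2.2 h'.2.1 h'.2.2)

lemma mem_closedCell_floorPoint (x : ℝ × ℝ) : x ∈ closedCell (floorPoint x) :=
  ⟨⟨Int.floor_le _, (Int.lt_floor_add_one _).le⟩, ⟨Int.floor_le _, (Int.lt_floor_add_one _).le⟩⟩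

lemma IsFractalSquare.mem_closedCell (hn : 2 ≤ n) (hD : ∀ d ∈ D, d.1 < n ∧ d.2 < n)
    (hF : IsFractalSquare n D F) {x : ℝ × ℝ} {z : ℤ × ℤ} (hx : x - latticePoint z ∈ F) :
    x ∈ closedCell z := by
  have := hF.mem_unit hn hD hx
  simp only [Prod.fst_sub, Prod.snd_sub, latticePoint_fst, latticePoint_snd] at this
  exact ⟨⟨by linarith, by linarith⟩, ⟨by linarith, by linarith⟩⟩

lemma IsFractalSquare.sub_mem_of_mem_openCell (hn : 2 ≤ n) (hD : ∀ d ∈ D, d.1 < n ∧ d.2 < n)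
    (hF : IsFractalSquare n D F) {x : ℝ × ℝ} {z : ℤ × ℤ} (hx : x ∈ openCell z)
    (hxH : x ∈ periodicExtension F) : x - latticePoint z ∈ F := by
  obtain ⟨w, hw⟩ := mem_periodicExtension.1 hxH
  rwa [eq_of_mem_openCell hx (hF.mem_closedCell hn hD hw)]

/-- The integer points not congruent modulo `n` to a digit. -/
def IsGap (n : ℕ) (D : Finset (ℕ × ℕ)) (z : ℤ × ℤ) : Prop :=
  ∀ d ∈ D, ∀ w : ℤ × ℤ, z ≠ (n * w.1 + d.1, n * w.2 + d.2)

/-- After expansion by `n`, a point of `H` lies in a closed unit cell indexed by a digit modulo `n`,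
and such a cell meets no other open cell. -/
lemma IsFractalSquare.notMem_of_gap (hn : 2 ≤ n) (hD : ∀ d ∈ D, d.1 < n ∧ d.2 < n)
    (hF : IsFractalSquare n D F) {x : ℝ × ℝ} {z : ℤ × ℤ} (hz : IsGap n D z)
    (hx : (n : ℝ) • x ∈ openCell z) : x ∉ periodicExtension F := by
  intro h
  obtain ⟨w, hw⟩ := mem_periodicExtension.1 h
  obtain ⟨d, hd, h⟩ := hF.exists_digit (by omega) hw
  refine hz d hd w (eq_of_mem_openCell hx (hF.mem_closedCell hn hD ?_))
  convert h using 1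
  ext
  · simp; ring
  · simp; ring

lemma exists_isGap (hD : ∀ d ∈ D, d.1 < n ∧ d.2 < n) (hD_lt : D.card < n ^ 2) :
    ∃ z, IsGap n D z := by
  obtain ⟨d, hd, hdD⟩ : ∃ d ∈ Finset.range n ×ˢ Finset.range n, d ∉ D := by
    by_contra! h
    have := Finset.card_le_card h
    rw [Finset.card_product, Finset.card_range, ← sq] at this
    omega
  rw [Finset.mem_product, Finset.mem_range, Finset.mem_range] at hd
  refine ⟨(d.1, d.2), fun d' hd' w h => hdD ?_⟩
  have key : ∀ a b : ℕ, a < n → b < n → ∀ c : ℤ, (a : ℤ) = n * c + b → a = b := by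
    intro a b ha hb c h
    have h1 : (a : ℤ) % n = b % n := by rw [h, Int.mul_add_emod_self_left]
    rw [Int.emod_eq_of_lt (by omega) (by omega), Int.emod_eq_of_lt (by omega) (by omega)] at h1
    exact_mod_cast h1
  rw [Prod.mk.injEq] at h
  have e1 := key _ _ hd.1 (hD d' hd').1 _ h.1
  have e2 := key _ _ hd.2 (hD d' hd').2 _ h.2
  rwa [Prod.ext e1 e2]

/-- The centre of the small cell of side `1 / n` indexed by `z`. -/
noncomputable def smallCentre (n : ℕ) (z : ℤ × ℤ) : ℝ × ℝ :=
  (n : ℝ)⁻¹ • (latticePoint z + (1 / 2, 1 / 2))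

lemma smul_smallCentre_mem (hn : n ≠ 0) (z : ℤ × ℤ) : (n : ℝ) • smallCentre n z ∈ openCell z := by
  rw [smallCentre, smul_smul, mul_inv_cancel₀ (by positivity), one_smul]
  constructor <;> constructor <;> simp <;> norm_num

lemma IsFractalSquare.compl_nonempty (hn : 2 ≤ n) (hD : ∀ d ∈ D, d.1 < n ∧ d.2 < n)
    (hD_lt : D.card < n ^ 2) (hF : IsFractalSquare n D F) : (periodicExtension F)ᶜ.Nonempty := by
  obtain ⟨z, hz⟩ := exists_isGap hD hD_lt
  exact ⟨_, hF.notMem_of_gap hn hD hz (smul_smallCentre_mem (by omega) z)⟩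

/-! ### Loops of winding number zero around the origin, expressed through logarithms. -/

/-- A loop in the complex plane which has a continuous logarithm that is itself a loop. -/
def HasPeriodicLog (Γ : I → ℂ) : Prop :=
  ∃ g : I → ℂ, Continuous g ∧ (∀ t, Complex.exp (g t) = Γ t) ∧ g 0 = g 1

/-- Rouché: `Γ' / Γ` stays in the disc of radius 1 about 1, where the principal logarithm is
continuous. -/
lemma HasPeriodicLog.perturb {Γ Γ' : I → ℂ} (h : HasPeriodicLog Γ) (hΓ : Continuous Γ)
    (hΓ' : Continuous Γ') (hloop : Γ' 0 = Γ' 1) (hlt : ∀ t, ‖Γ' t - Γ t‖ < ‖Γ t‖) :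
    HasPeriodicLog Γ' := by
  obtain ⟨g, hg, hexp, h01⟩ := h
  have hne : ∀ t, Γ t ≠ 0 := fun t => by
    rw [← norm_pos_iff]; exact (norm_nonneg _).trans_lt (hlt t)
  have hΓ01 : Γ 0 = Γ 1 := by rw [← hexp, ← hexp, h01]
  have hslit : ∀ t, 1 + (Γ' t - Γ t) / Γ t ∈ Complex.slitPlane := fun t => by
    apply Complex.mem_slitPlane_of_norm_lt_one
    rw [norm_div, div_lt_one (norm_pos_iff.2 (hne t))]
    exact hlt t
  refine ⟨fun t => g t + Complex.log (1 + (Γ' t - Γ t) / Γ t), ?_, fun t => ?_, ?_⟩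
  · refine hg.add (Continuous.clog ?_ hslit)
    exact continuous_const.add ((hΓ'.sub hΓ).div hΓ hne)
  · rw [Complex.exp_add, hexp, Complex.exp_log (Complex.slitPlane_ne_zero (hslit t))]
    field_simp [hne t]
    ring
  · simp only [h01, hΓ01, hloop]

lemma HasPeriodicLog.perturb' {Γ Γ' : I → ℂ} (h : HasPeriodicLog Γ) (hΓ : Continuous Γ)
    (hΓ' : Continuous Γ') (hloop : Γ' 0 = Γ' 1) (hlt : ∀ t, ‖Γ' t - Γ t‖ < ‖Γ' t‖) :
    HasPeriodicLog Γ' := by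
  obtain ⟨g, hg, hexp, h01⟩ := h
  have hne : ∀ t, Γ' t ≠ 0 := fun t => by
    rw [← norm_pos_iff]; exact (norm_nonneg _).trans_lt (hlt t)
  have hΓ01 : Γ 0 = Γ 1 := by rw [← hexp, ← hexp, h01]
  have hslit : ∀ t, 1 + (Γ t - Γ' t) / Γ' t ∈ Complex.slitPlane := fun t => by
    apply Complex.mem_slitPlane_of_norm_lt_one
    rw [norm_div, div_lt_one (norm_pos_iff.2 (hne t)), norm_sub_rev]
    exact hlt t
  refine ⟨fun t => g t - Complex.log (1 + (Γ t - Γ' t) / Γ' t), ?_, fun t => ?_, ?_⟩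
  · refine hg.sub (Continuous.clog ?_ hslit)
    exact continuous_const.add ((hΓ.sub hΓ').div hΓ' hne)
  · have hΓt : Γ t ≠ 0 := by rw [← hexp]; exact Complex.exp_ne_zero _
    rw [Complex.exp_sub, hexp, Complex.exp_log (Complex.slitPlane_ne_zero (hslit t))]
    have : 1 + (Γ t - Γ' t) / Γ' t = Γ t / Γ' t := by field_simp [hne t]; ring
    rw [this]
    field_simp
  · simp only [h01, hΓ01, hloop]

lemma hasPeriodicLog_const {c : ℂ} (hc : c ≠ 0) : HasPeriodicLog fun _ => c :=
  ⟨fun _ => Complex.log c, continuous_const, fun _ => Complex.exp_log hc, rfl⟩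

/-- Two continuous logarithms of one curve differ by a continuous, hence constant, multiple of
`2πi`, so their increments over `I` agree. -/
lemma not_hasPeriodicLog_exp {h : I → ℂ} (hh : Continuous h) (h01 : h 0 ≠ h 1) :
    ¬ HasPeriodicLog fun t => Complex.exp (h t) := by
  rintro ⟨g, hg, hexp, hg01⟩
  have hint : ∀ t, ∃ k : ℤ, (g t - h t) / (2 * Real.pi * Complex.I) = k := fun t => by
    obtain ⟨k, hk⟩ := Complex.exp_eq_exp_iff_exists_int.1 (hexp t)
    exact ⟨k, by rw [hk]; field_simp [Complex.two_pi_I_ne_zero]; ring⟩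
  choose k hk using hint
  have hcont : Continuous fun t => (k t : ℝ) := by
    have : (fun t => (k t : ℝ)) = fun t => ((g t - h t) / (2 * Real.pi * Complex.I)).re := by
      funext t; rw [hk]; simp
    rw [this]
    exact Complex.continuous_re.comp ((hg.sub hh).div_const _)
  have hk' : Continuous k := Int.isClosedEmbedding_coe_real.isEmbedding.continuous_iff.2 hcont
  have := PreconnectedSpace.constant (inferInstance : PreconnectedSpace I) hk' (x := 0) (y := 1)
  have e0 := hk 0
  rw [this, ← hk 1, hg01] at e0
  exact h01 (by
    have := Complex.two_pi_I_ne_zero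
    field_simp at e0
    linear_combination -e0)

/-- Homotopy invariance. By compactness of `I`, nearby parameters give loops that are small
perturbations of each other, in both directions, so the property is locally constant. -/
lemma HasPeriodicLog.of_family {X : Type*} [TopologicalSpace X] [PreconnectedSpace X]
    {G : X → I → ℂ} (hG : Continuous (Function.uncurry G)) (hloop : ∀ x, G x 0 = G x 1)
    (hne : ∀ x t, G x t ≠ 0) {x y : X} (h : HasPeriodicLog (G x)) : HasPeriodicLog (G y) := by
  have hGx : ∀ x, Continuous (G x) := fun x => hG.comp (Continuous.prodMk_right x)
  have hloc : IsLocallyConstant fun x => HasPeriodicLog (G x) := by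
    rw [IsLocallyConstant.iff_eventually_eq]
    intro x₀
    have hev : ∀ᶠ x in 𝓝 x₀, ∀ t ∈ (univ : Set I),
        ‖G x t - G x₀ t‖ < ‖G x₀ t‖ ∧ ‖G x t - G x₀ t‖ < ‖G x t‖ := by
      refine isCompact_univ.eventually_forall_of_forall_eventually fun t _ => ?_
      have c1 : Continuous fun p : X × I => ‖G p.1 p.2 - G x₀ p.2‖ :=
        (hG.sub ((hGx x₀).comp continuous_snd)).norm
      have c2 : Continuous fun p : X × I => ‖G x₀ p.2‖ := ((hGx x₀).comp continuous_snd).norm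
      have c3 : Continuous fun p : X × I => ‖G p.1 p.2‖ := hG.norm
      refine (c1.continuousAt.eventually_lt c2.continuousAt ?_).and
        (c1.continuousAt.eventually_lt c3.continuousAt ?_) <;> simpa using hne x₀ t
    filter_upwards [hev] with x hx
    refine propext ⟨fun h => ?_, fun h => ?_⟩
    · refine h.perturb (hGx _) (hGx _) (hloop _) fun t => ?_
      rw [norm_sub_rev]
      exact (hx t trivial).2
    · exact h.perturb (hGx _) (hGx _) (hloop _) fun t => (hx t trivial).1
  have := hloc.apply_eq_of_preconnectedSpace x y
  exact this ▸ h

/-! ### The frontier of a bounded set, seen from a point of the set. -/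

/-- The identification of the plane with `ℂ`. -/
noncomputable def toComplex : (ℝ × ℝ) ≃L[ℝ] ℂ := Complex.equivRealProdCLM.symm

@[simp] lemma toComplex_re (x : ℝ × ℝ) : (toComplex x).re = x.1 := rfl
@[simp] lemma toComplex_im (x : ℝ × ℝ) : (toComplex x).im = x.2 := rfl

/-- A component of a compact set has arbitrarily small relatively clopen neighbourhoods. -/
lemma exists_isClopen_subset {X : Type*} [TopologicalSpace X] [T2Space X] [CompactSpace X] (x : X)
    {O : Set X} (hO : IsOpen O) (h : connectedComponent x ⊆ O) :
    ∃ V : Set X, IsClopen V ∧ x ∈ V ∧ V ⊆ O := by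
  rw [connectedComponent_eq_iInter_isClopen] at h
  have : Nonempty { s : Set X // IsClopen s ∧ x ∈ s } := ⟨⟨univ, isClopen_univ, trivial⟩⟩
  obtain ⟨V, hV⟩ := exists_subset_nhds_of_isCompact'
    (V := fun s : { s : Set X // IsClopen s ∧ x ∈ s } => (s : Set X))
    (fun a b => ⟨⟨a.1 ∩ b.1, a.2.1.inter b.2.1, a.2.2, b.2.2⟩, inter_subset_left,
      inter_subset_right⟩) (fun s => s.2.1.isClosed.isCompact) (fun s => s.2.1.isClosed)
    (fun y hy => hO.mem_nhds (h hy))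
  exact ⟨V, V.2.1, V.2.2, hV⟩

/-- Each component is sent into an open half-plane with 0 on its border, and so is a clopen
neighbourhood, where a branch of the logarithm exists. Branches on finitely many clopen sets glue
without any compatibility. -/
lemma exists_continuous_log {X : Type*} [TopologicalSpace X] [T2Space X] [CompactSpace X]
    {f : X → ℂ} (hf : Continuous f)
    (h : ∀ x, ∃ u : ℂ, ∀ y ∈ connectedComponent x, 0 < (u * f y).re) :
    ∃ θ : X → ℂ, Continuous θ ∧ ∀ x, Complex.exp (θ x) = f x := by
  have key : ∃ V : Set X, (univ : Set X) ⊆ V ∧ IsClopen V ∧ ∃ θ : X → ℂ, ∀ x ∈ V,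
      ContinuousAt θ x ∧ Complex.exp (θ x) = f x := by
    refine isCompact_univ.induction_on (p := fun S => ∃ V : Set X, S ⊆ V ∧ IsClopen V ∧
      ∃ θ : X → ℂ, ∀ x ∈ V, ContinuousAt θ x ∧ Complex.exp (θ x) = f x) ?_ ?_ ?_ ?_
    · exact ⟨∅, Subset.rfl, isClopen_empty, fun _ => 0, fun x hx => hx.elim⟩
    · rintro S T hST ⟨V, hTV, hV⟩
      exact ⟨V, hST.trans hTV, hV⟩
    · rintro S T ⟨V, hSV, hV, θ, hθ⟩ ⟨W, hTW, hW, η, hη⟩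
      classical
      refine ⟨V ∪ W, union_subset_union hSV hTW, hV.union hW, V.piecewise θ η, fun x hx => ?_⟩
      by_cases hxV : x ∈ V
      · refine ⟨(hθ x hxV).1.congr ?_, ?_⟩
        · filter_upwards [hV.isOpen.mem_nhds hxV] with y hy
          rw [piecewise_eq_of_mem _ _ _ hy]
        · rw [piecewise_eq_of_mem _ _ _ hxV, (hθ x hxV).2]
      · have hxW : x ∈ W := hx.resolve_left hxV
        refine ⟨(hη x hxW).1.congr ?_, ?_⟩
        · filter_upwards [hV.compl.isOpen.mem_nhds hxV] with y hy
          rw [piecewise_eq_of_notMem _ _ _ hy]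
        · rw [piecewise_eq_of_notMem _ _ _ hxV, (hη x hxW).2]
    · intro x _
      obtain ⟨u, hu⟩ := h x
      obtain ⟨V, hV, hxV, hVO⟩ := exists_isClopen_subset x
        (isOpen_lt continuous_const (Complex.continuous_re.comp (continuous_const.mul hf))) hu
      refine ⟨V, mem_nhdsWithin_of_mem_nhds (hV.isOpen.mem_nhds hxV), V, Subset.rfl, hV,
        fun y => Complex.log (u * f y) - Complex.log u, fun y hy => ?_⟩
      have hy' : 0 < (u * f y).re := hVO hy
      have hne : u * f y ≠ 0 := fun h0 => by simp [h0] at hy'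
      refine ⟨((continuous_const.mul hf).continuousAt.clog (Or.inl hy')).sub
        continuousAt_const, ?_⟩
      rw [Complex.exp_sub, Complex.exp_log hne, Complex.exp_log (left_ne_zero_of_mul hne)]
      field_simp [left_ne_zero_of_mul hne]
  obtain ⟨V, hV, -, θ, hθ⟩ := key
  exact ⟨θ, continuous_iff_continuousAt.2 fun x => (hθ x (hV trivial)).1,
    fun x => (hθ x (hV trivial)).2⟩

/-- Otherwise `z - p` has a continuous logarithm on the frontier. Extending it to the plane and
using its exponential on `closure U` changes `z - p` into a nowhere vanishing map `φ`, equal to `z -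
p` far away. A large circle around `p` then has winding number 0 by contraction to `p`, and 1 by
direct computation. -/
lemma exists_frontier_component_not_subset_halfPlane {U : Set (ℝ × ℝ)}
    (hb : Bornology.IsBounded U) {p : ℝ × ℝ} (hp : p ∈ U) :
    ∃ x ∈ frontier U, ∀ f : (ℝ × ℝ) →L[ℝ] ℝ,
      ∃ y ∈ connectedComponentIn (frontier U) x, f y ≤ f p := by
  by_contra! hcon
  have hK : IsCompact (frontier U) :=
    Metric.isCompact_of_isClosed_isBounded isClosed_frontier
      (hb.closure.subset frontier_subset_closure)
  have : CompactSpace (frontier U) := isCompact_iff_compactSpace.1 hK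
  have hf : Continuous fun x : ℝ × ℝ => toComplex x - toComplex p :=
    toComplex.continuous.sub continuous_const
  obtain ⟨θ, hθ, hθexp⟩ := exists_continuous_log (hf.comp continuous_subtype_val :
      Continuous fun x : frontier U => toComplex x - toComplex p) (fun x => by
    obtain ⟨f, hf⟩ := hcon x x.2
    -- With `u = f (1, 0) - i f (0, 1)`, the real part of `u * z` is `f z`.
    refine ⟨⟨f (1, 0), -f (0, 1)⟩, fun y hy => ?_⟩
    have hy' : (y : ℝ × ℝ) ∈ connectedComponentIn (frontier U) x := by
      rw [connectedComponentIn_eq_image x.2]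
      exact ⟨y, hy, rfl⟩
    have key : ∀ z : ℝ × ℝ, f z = z.1 * f (1, 0) + z.2 * f (0, 1) := fun z => by
      have : z = z.1 • ((1 : ℝ), (0 : ℝ)) + z.2 • ((0 : ℝ), (1 : ℝ)) := by ext <;> simp
      conv_lhs => rw [this, map_add, map_smul, map_smul]
      simp
    have h := hf y hy'
    rw [key p, key y] at h
    simp only [Function.comp_apply, Complex.mul_re, Complex.sub_re, Complex.sub_im, toComplex_re, toComplex_im]
    linarith)
  -- Tietze extension of the logarithm from the frontier to the whole plane.
  obtain ⟨Θ, hΘ⟩ := ContinuousMap.exists_restrict_eq isClosed_frontier ⟨θ, hθ⟩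
  classical
  let φ : ℝ × ℝ → ℂ := (closure U).piecewise (fun z => Complex.exp (Θ z))
    (fun z => toComplex z - toComplex p)
  have hφ : Continuous φ := by
    refine Continuous.piecewise (fun z hz => ?_) (Complex.continuous_exp.comp Θ.continuous) hf
    have hz' : z ∈ frontier U := frontier_closure_subset hz
    have : Θ z = θ ⟨z, hz'⟩ := by
      have := congrArg (fun g => g ⟨z, hz'⟩) hΘ
      simpa using this
    rw [this, hθexp, Function.comp_apply]
  have hφne : ∀ z, φ z ≠ 0 := fun z => by
    by_cases hz : z ∈ closure U
    · simp only [φ, piecewise_eq_of_mem _ _ _ hz]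
      exact Complex.exp_ne_zero _
    · simp only [φ, piecewise_eq_of_notMem _ _ _ hz]
      rw [sub_ne_zero]
      intro h
      exact hz (toComplex.injective h ▸ subset_closure hp)
  obtain ⟨R, hR, hUR⟩ : ∃ R > 0, ∀ z ∈ closure U, ‖toComplex z - toComplex p‖ < R := by
    have hc : IsCompact (closure U) :=
      Metric.isCompact_of_isClosed_isBounded isClosed_closure hb.closure
    obtain ⟨C, hC⟩ := (hc.image hf).isBounded.exists_norm_le
    refine ⟨|C| + 1, by positivity, fun z hz => ?_⟩
    have := hC _ (mem_image_of_mem _ hz)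
    linarith [le_abs_self C]
  let ray : ℝ → I → ℝ × ℝ := fun s t =>
    p + toComplex.symm ((s * R : ℝ) * Complex.exp (2 * Real.pi * Complex.I * (t : ℝ)))
  have hray : Continuous (Function.uncurry fun s t => φ (ray s t)) := by
    refine hφ.comp (continuous_const.add (toComplex.symm.continuous.comp ?_))
    fun_prop
  have h0 : HasPeriodicLog fun t => φ (ray 0 t) := by
    simp only [ray, zero_mul, Complex.ofReal_zero, map_zero, add_zero]
    exact hasPeriodicLog_const (hφne p)
  have h1 : HasPeriodicLog fun t => φ (ray 1 t) :=
    HasPeriodicLog.of_family (G := fun s t => φ (ray s t)) hray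
      (fun s => by simp [ray, Complex.exp_two_pi_mul_I]) (fun s t => hφne _) h0
  refine not_hasPeriodicLog_exp (h := fun t : I =>
    (Real.log R : ℂ) + 2 * Real.pi * Complex.I * (t : ℝ)) (by fun_prop) (by simp) ?_
  convert h1 using 2 with t
  have hval : toComplex (ray 1 t) - toComplex p =
      R * Complex.exp (2 * Real.pi * Complex.I * (t : ℝ)) := by
    simp [ray]
  have hnorm : ‖toComplex (ray 1 t) - toComplex p‖ = R := by
    rw [hval, norm_mul, show (2 * Real.pi * Complex.I * ((t : ℝ) : ℂ)) =
      ((2 * Real.pi * t : ℝ) : ℂ) * Complex.I by push_cast; ring, Complex.norm_exp_ofReal_mul_I]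
    simp [abs_of_pos hR]
  have hnot : ray 1 t ∉ closure U := fun h => (hUR _ h).ne hnorm
  simp only [φ, piecewise_eq_of_notMem _ _ _ hnot]
  rw [hval, Complex.exp_add, ← Complex.ofReal_exp, Real.exp_log hR]

/-! ### Connected sets cannot cross a periodic curve. -/

/-- The determinant of two vectors of the plane. -/
def cross (v x : ℝ × ℝ) : ℝ := v.1 * x.2 - v.2 * x.1

lemma continuous_cross (v : ℝ × ℝ) : Continuous (cross v) := by
  unfold cross; fun_prop

lemma cross_add (v x y : ℝ × ℝ) : cross v (x + y) = cross v x + cross v y := by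
  simp [cross]; ring

lemma cross_sub (v x y : ℝ × ℝ) : cross v (x - y) = cross v x - cross v y := by
  simp [cross]; ring

lemma cross_smul (v x : ℝ × ℝ) (t : ℝ) : cross v (t • x) = t * cross v x := by
  simp [cross]; ring

lemma cross_comm (v x : ℝ × ℝ) : cross v x = -cross x v := by
  simp [cross]; ring

lemma exists_smul_of_cross_eq_zero {v x : ℝ × ℝ} (hv : v ≠ 0) (h : cross v x = 0) :
    ∃ t : ℝ, x = t • v := by
  unfold cross at h
  by_cases h1 : v.1 = 0
  · have h2 : v.2 ≠ 0 := fun h2 => hv (Prod.ext h1 h2)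
    rw [h1, zero_mul, zero_sub, neg_eq_zero, mul_eq_zero] at h
    refine ⟨x.2 / v.2, Prod.ext ?_ ?_⟩
    · simp [h1, h.resolve_left h2]
    · simp [h2]
  · refine ⟨x.1 / v.1, Prod.ext ?_ ?_⟩
    · simp [h1]
    · simp only [Prod.smul_snd, smul_eq_mul]
      field_simp
      linarith

/-- The height of a point over the line spanned by `v`. -/
noncomputable def height (v x : ℝ × ℝ) : ℝ := (toComplex x / toComplex v).im

lemma height_eq (v x : ℝ × ℝ) : height v x = cross v x / (v.1 ^ 2 + v.2 ^ 2) := by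
  rw [height, Complex.div_im, Complex.normSq_apply, cross]
  simp only [toComplex_re, toComplex_im]
  ring

lemma continuous_height (v : ℝ × ℝ) : Continuous (height v) :=
  Complex.continuous_im.comp (toComplex.continuous.div_const _)

lemma norm_exp_height (v x : ℝ × ℝ) :
    ‖Complex.exp (2 * Real.pi * Complex.I * (toComplex x / toComplex v))‖ =
      Real.exp (-(2 * Real.pi * height v x)) := by
  rw [Complex.norm_exp, height]
  congr 1
  rw [show (2 * Real.pi * Complex.I : ℂ) = ((2 * Real.pi : ℝ) : ℂ) * Complex.I by push_cast; rfl]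
  rw [mul_assoc, Complex.re_ofReal_mul, Complex.I_mul_re]
  ring

lemma norm_exp_height_lt {v x y : ℝ × ℝ} (h : height v x < height v y) :
    ‖Complex.exp (2 * Real.pi * Complex.I * (toComplex y / toComplex v))‖ <
      ‖Complex.exp (2 * Real.pi * Complex.I * (toComplex x / toComplex v))‖ := by
  rw [norm_exp_height, norm_exp_height, Real.exp_lt_exp]
  have := Real.pi_pos
  nlinarith

/-- A connected set which avoids all translates of a curve from `x` to `x + v` by multiples of `v`
does not have points on both sides of these translates. -/
lemma not_crossing {γ : I → ℝ × ℝ} (hγ : Continuous γ) {v : ℝ × ℝ} (hv : v ≠ 0)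
    (hγv : γ 1 = γ 0 + v) {E : Set (ℝ × ℝ)} (hE : IsPreconnected E)
    (hdisj : ∀ t, ∀ a ∈ E, ∀ k : ℤ, γ t ≠ a + (k : ℝ) • v) {a b : ℝ × ℝ} (ha : a ∈ E) (hb : b ∈ E)
    (hat : ∀ t, height v (γ t) < height v a) (hbt : ∀ t, height v b < height v (γ t)) : False := by
  -- `ζ` realises the quotient of the plane by `ℤ v` as the punctured plane; `γ` becomes a closed
  -- loop, and greater height means smaller modulus.
  let ζ : ℝ × ℝ → ℂ := fun x =>
    Complex.exp (2 * Real.pi * Complex.I * (toComplex x / toComplex v))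
  have hv' : toComplex v ≠ 0 := fun h => hv (toComplex.injective (by simpa using h))
  have hζ : Continuous ζ := Complex.continuous_exp.comp
    (continuous_const.mul (toComplex.continuous.div_const _))
  have hζv : ∀ x, ζ (x + v) = ζ x := fun x => by
    simp only [ζ]
    rw [map_add, add_div, div_self hv', mul_add, mul_one, Complex.exp_add,
      Complex.exp_two_pi_mul_I, mul_one]
  have hζγ : Continuous fun t => ζ (γ t) := hζ.comp hγ
  have : PreconnectedSpace E := isPreconnected_iff_preconnectedSpace.1 hE
  have hfam : ∀ x y : E, HasPeriodicLog (fun t => ζ (γ t) - ζ x) →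
      HasPeriodicLog (fun t => ζ (γ t) - ζ y) := fun x y h => by
    refine HasPeriodicLog.of_family (G := fun (x : E) t => ζ (γ t) - ζ x) ?_ ?_ ?_ h
    · exact (hζγ.comp continuous_snd).sub (hζ.comp (continuous_subtype_val.comp continuous_fst))
    · intro x; simp only [hγv, hζv]
    · intro x t h0
      obtain ⟨k, hk⟩ := Complex.exp_eq_exp_iff_exists_int.1 (sub_eq_zero.1 h0)
      refine hdisj t x x.2 k (toComplex.injective ?_)
      rw [map_add, map_smul, Complex.real_smul]
      have := Complex.two_pi_I_ne_zero
      field_simp at hk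
      rw [hk]; push_cast; ring
  -- Since `ζ b` is larger in modulus than the whole loop, the loop does not wind around it. By
  -- connectedness of `E` it does not wind around `ζ a` either; but `ζ a` is smaller than the loop,
  -- so the loop winds around it as around 0, namely once.
  have hblog : HasPeriodicLog fun t => ζ (γ t) - ζ b := by
    refine (hasPeriodicLog_const (neg_ne_zero.2 (Complex.exp_ne_zero _))).perturb (Γ := fun _ => -ζ b)
      continuous_const (hζγ.sub continuous_const) (by simp only [hγv, hζv]) fun t => ?_
    rw [sub_neg_eq_add, sub_add_cancel, norm_neg]
    exact norm_exp_height_lt (hbt t)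
  have halog := hfam ⟨b, hb⟩ ⟨a, ha⟩ hblog
  refine not_hasPeriodicLog_exp
    (h := fun t => 2 * Real.pi * Complex.I * (toComplex (γ t) / toComplex v))
    (continuous_const.mul ((toComplex.continuous.comp hγ).div_const _)) ?_ ?_
  · intro h
    have h' := mul_left_cancel₀ Complex.two_pi_I_ne_zero h
    rw [hγv, map_add, add_div, div_self hv'] at h'
    simp at h'
  · refine halog.perturb' (Γ' := fun t => ζ (γ t)) (hζγ.sub continuous_const) hζγ
      (by simp only [hγv, hζv]) fun t => ?_
    rw [sub_sub_cancel]
    exact norm_exp_height_lt (hat t)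

lemma height_add (v x y : ℝ × ℝ) : height v (x + y) = height v x + height v y := by
  simp only [height_eq, cross_add, add_div]

lemma height_smul (v x : ℝ × ℝ) (t : ℝ) : height v (t • x) = t * height v x := by
  simp only [height_eq, cross_smul, mul_div_assoc]

lemma sum_sq_pos {v : ℝ × ℝ} (hv : v ≠ 0) : 0 < v.1 ^ 2 + v.2 ^ 2 := by
  by_contra! h
  exact hv (Prod.ext (by simp; nlinarith [sq_nonneg v.1, sq_nonneg v.2])
    (by simp; nlinarith [sq_nonneg v.1, sq_nonneg v.2]))

lemma exists_lattice_cross_pos {v : ℝ × ℝ} (hv : v ≠ 0) :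
    ∃ z : ℤ × ℤ, 0 < cross v (latticePoint z) := by
  rcases lt_trichotomy v.1 0 with h | h | h
  · exact ⟨(0, -1), by simp [cross, h]⟩
  · have h2 : v.2 ≠ 0 := fun h2 => hv (Prod.ext h h2)
    rcases h2.lt_or_gt with h2 | h2
    · exact ⟨(1, 0), by simp [cross, h2]⟩
    · exact ⟨(-1, 0), by simp [cross, h2]⟩
  · exact ⟨(0, 1), by simp [cross, h]⟩

/-- If the complement of `F + ℤ²` contains a curve joining two points which differ by an integer
vector `v`, then the connected subsets of `F + ℤ²` have bounded width transversally to `v`. -/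
lemma exists_height_bound {γ : I → ℝ × ℝ} (hγ : Continuous γ) {v : ℤ × ℤ} (hv : v ≠ 0)
    (hγv : γ 1 = γ 0 + latticePoint v) (hγH : ∀ t, γ t ∉ periodicExtension F) :
    ∃ M : ℝ, ∀ E : Set (ℝ × ℝ), IsPreconnected E → E ⊆ periodicExtension F → ∀ a ∈ E, ∀ b ∈ E,
      height (latticePoint v) a - height (latticePoint v) b ≤ M := by
  set w := latticePoint v with hw
  have hw0 : w ≠ 0 := fun h => hv (latticePoint_injective (by rw [← hw, h, latticePoint_zero]))
  obtain ⟨C, hC⟩ := (isCompact_range ((continuous_height w).comp hγ)).isBounded.exists_norm_le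
  have hC' : ∀ t, |height w (γ t)| ≤ C := fun t => hC _ (mem_range_self t)
  obtain ⟨z, hz⟩ := exists_lattice_cross_pos hw0
  have hδ : 0 < height w (latticePoint z) := by
    rw [height_eq]; exact div_pos hz (sum_sq_pos hw0)
  set δ := height w (latticePoint z) with hδdef
  refine ⟨2 * C + δ + 1, fun E hE hEH a ha b hb => ?_⟩
  by_contra! hab
  -- The translation places `b` at a height in `[-C - δ - 1/2, -C - 1/2)`, just below the band `[-C,
  -- C]` of `γ`; the assumed width then puts `a` above the band.
  obtain ⟨m, ⟨hm1, hm2⟩, -⟩ := existsUnique_add_zsmul_mem_Ico hδ (height w b) (-C - δ - 1/2)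
  have hadd : ∀ x, height w (x + latticePoint (m • z)) = height w x + m • δ := fun x => by
    rw [height_add, latticePoint_zsmul, height_smul, zsmul_eq_mul]
  refine not_crossing hγ hw0 hγv (E := (fun x => x + latticePoint (m • z)) '' E)
    (hE.image _ (by fun_prop)) ?_ (mem_image_of_mem _ ha) (mem_image_of_mem _ hb) ?_ ?_
  · rintro t _ ⟨x, hx, rfl⟩ k h
    apply hγH t
    rw [h, hw, ← latticePoint_zsmul, add_latticePoint_mem, add_latticePoint_mem]
    exact hEH hx
  · intro t
    rw [hadd]
    have := abs_le.1 (hC' t)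
    linarith [this.2]
  · intro t
    rw [hadd]
    have := abs_le.1 (hC' t)
    linarith [this.1]

/-- The width bound is the same for all connected subsets of `H`, and the blow-ups `n ^ k • C`
multiply the width of `C` by `n ^ k`. -/
lemma IsFractalSquare.cross_eq_zero_of_loop (hn : 2 ≤ n) (hF : IsFractalSquare n D F)
    {γ : I → ℝ × ℝ} (hγ : Continuous γ) {v : ℤ × ℤ} (hv : v ≠ 0)
    (hγv : γ 1 = γ 0 + latticePoint v) (hγH : ∀ t, γ t ∉ periodicExtension F)
    {C : Set (ℝ × ℝ)} (hC : IsPreconnected C) (hCF : C ⊆ F) {x y : ℝ × ℝ} (hx : x ∈ C)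
    (hy : y ∈ C) : cross (latticePoint v) (x - y) = 0 := by
  obtain ⟨M, hM⟩ := exists_height_bound hγ hv hγv hγH
  have hw0 : latticePoint v ≠ 0 := fun h => hv (latticePoint_injective (by rw [h, latticePoint_zero]))
  have key : ∀ x ∈ C, ∀ y ∈ C, height (latticePoint v) (x - y) ≤ 0 := by
    intro x hx y hy
    by_contra! hpos
    obtain ⟨k, hk⟩ := pow_unbounded_of_one_lt (M / height (latticePoint v) (x - y))
      (show (1 : ℝ) < n by exact_mod_cast hn)
    rw [div_lt_iff₀ hpos] at hk
    have := hM ((fun x => (n : ℝ) ^ k • x) '' C) (hC.image _ (by fun_prop))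
      (by rintro _ ⟨x, hx, rfl⟩
          exact hF.pow_smul_mem (by omega) k (subset_periodicExtension F (hCF hx)))
      _ (mem_image_of_mem _ hx) _ (mem_image_of_mem _ hy)
    rw [height_smul, height_smul] at this
    rw [sub_eq_add_neg, height_add, ← neg_one_smul ℝ y, height_smul] at hk
    linarith
  have h1 := key x hx y hy
  have h2 := key y hy x hx
  rw [height_eq, div_le_iff₀ (sum_sq_pos hw0), zero_mul] at h1 h2
  rw [← neg_sub x y, ← neg_one_smul ℝ, cross_smul] at h2
  linarith

/-! ### From an unbounded component of the complement to a periodic curve. -/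

lemma IsFractalSquare.sq (hn : n ≠ 0) (hD : ∀ d ∈ D, d.1 < n ∧ d.2 < n)
    (hF : IsFractalSquare n D F) :
    ∃ D' : Finset (ℕ × ℕ), (∀ d ∈ D', d.1 < n ^ 2 ∧ d.2 < n ^ 2) ∧
      IsFractalSquare (n ^ 2) D' F := by
  have hn' : (n : ℝ) ≠ 0 := by positivity
  refine ⟨(D ×ˢ D).image fun p => (n * p.1.1 + p.2.1, n * p.1.2 + p.2.2), ?_,
    hF.isCompact, hF.nonempty, ?_⟩
  · intro d hd
    obtain ⟨p, hp, rfl⟩ := Finset.mem_image.1 hd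
    obtain ⟨h1, h2⟩ := Finset.mem_product.1 hp
    have e1 := hD _ h1
    have e2 := hD _ h2
    constructor
    · nlinarith [e1.1, e2.1]
    · nlinarith [e1.2, e2.2]
  · ext y
    constructor
    · intro hy
      obtain ⟨d, hd, h⟩ := hF.exists_digit hn hy
      obtain ⟨d', hd', h'⟩ := hF.exists_digit hn h
      refine ⟨_, h', _, Finset.mem_image_of_mem _ (Finset.mk_mem_product hd hd'), ?_⟩
      ext <;> simp <;> field_simp <;> ring
    · rintro ⟨x, hx, d, hd, rfl⟩
      obtain ⟨p, hp, rfl⟩ := Finset.mem_image.1 hd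
      obtain ⟨h1, h2⟩ := Finset.mem_product.1 hp
      convert hF.contract_mem (hF.contract_mem hx h2) h1 using 1
      ext <;> simp <;> field_simp <;> ring

/-- The union of the closed cells of side `1 / n` which are removed in the first step of the
construction of `F + ℤ²`. -/
def gapSet (n : ℕ) (D : Finset (ℕ × ℕ)) : Set (ℝ × ℝ) :=
  {x | ∃ z, IsGap n D z ∧ (n : ℝ) • x ∈ closedCell z}

lemma isClosedEmbedding_latticePoint : IsClosedEmbedding latticePoint :=
  Int.isClosedEmbedding_coe_real.prodMap Int.isClosedEmbedding_coe_real

lemma isClosed_biUnion_closedCell (S : Set (ℤ × ℤ)) : IsClosed (⋃ z ∈ S, closedCell z) := by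
  have h1 : IsClosed (latticePoint '' S) :=
    isClosedEmbedding_latticePoint.isClosedMap S (isClosed_discrete S)
  have h2 : IsCompact (closedCell 0) := isCompact_Icc.prod isCompact_Icc
  convert h1.add_left_of_isCompact h2 using 1
  ext x
  simp only [mem_iUnion, Set.mem_add, mem_image, exists_prop]
  constructor
  · rintro ⟨z, hz, hx⟩
    refine ⟨x - latticePoint z, ?_, _, ⟨z, hz, rfl⟩, by simp⟩
    obtain ⟨⟨a, b⟩, c, d⟩ := hx
    constructor <;> constructor <;> simp <;> linarith
  · rintro ⟨y, ⟨⟨a, b⟩, c, d⟩, _, ⟨z, hz, rfl⟩, rfl⟩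
    refine ⟨z, hz, ?_⟩
    simp only [Prod.fst_zero, Prod.snd_zero, Int.cast_zero] at a b c d
    constructor <;> constructor <;> simp <;> linarith

lemma isClosed_gapSet (n : ℕ) (D : Finset (ℕ × ℕ)) : IsClosed (gapSet n D) := by
  have := (isClosed_biUnion_closedCell {z | IsGap n D z}).preimage
    (continuous_const_smul (n : ℝ) : Continuous fun x : ℝ × ℝ => (n : ℝ) • x)
  convert this using 1
  ext x
  simp [gapSet]

/-- Off the removed cells, expansion by `n` preserves the complement of `H`; this is what allows
arcs to be expanded repeatedly. -/
lemma IsFractalSquare.smul_notMem (hn : 2 ≤ n) (hD : ∀ d ∈ D, d.1 < n ∧ d.2 < n)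
    (hF : IsFractalSquare n D F) {x : ℝ × ℝ} (hx : x ∉ periodicExtension F)
    (hxB : x ∉ gapSet n D) : (n : ℝ) • x ∉ periodicExtension F := by
  intro h
  obtain ⟨z, hz⟩ := mem_periodicExtension.1 h
  refine hxB ⟨z, fun d hd w hw => hx (mem_periodicExtension.2 ⟨w, ?_⟩),
    hF.mem_closedCell hn hD hz⟩
  convert hF.contract_mem hz hd using 1
  have hn' : (n : ℝ) ≠ 0 := by positivity
  subst hw
  ext <;> simp <;> field_simp <;> ring

lemma IsFractalSquare.smallCentre_mem_component (hn : 2 ≤ n) (hD : ∀ d ∈ D, d.1 < n ∧ d.2 < n)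
    (hF : IsFractalSquare n D F) {x : ℝ × ℝ} (hx : x ∉ periodicExtension F) {z : ℤ × ℤ}
    (hz : IsGap n D z) (hxz : (n : ℝ) • x ∈ closedCell z) :
    smallCentre n z ∈ connectedComponentIn (periodicExtension F)ᶜ x := by
  have hn' : (n : ℝ) ≠ 0 := by positivity
  set S : Set (ℝ × ℝ) := (fun y => (n : ℝ) • y) ⁻¹' openCell z with hS
  have hconv : Convex ℝ S :=
    ((convex_Ioo _ _).prod (convex_Ioo _ _)).is_linear_preimage (IsLinearMap.isLinearMap_smul _)
  have hcl : x ∈ closure S := by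
    have := (Homeomorph.smulOfNeZero (n : ℝ) hn' : (ℝ × ℝ) ≃ₜ (ℝ × ℝ)).preimage_closure (openCell z)
    rw [closure_openCell] at this
    exact this.le hxz
  have hpre : IsPreconnected (insert x S) :=
    hconv.isPreconnected.subset_closure (subset_insert _ _)
      (insert_subset hcl subset_closure)
  refine hpre.subset_connectedComponentIn (mem_insert _ _) ?_
    (mem_insert_of_mem _ (smul_smallCentre_mem (by omega) z))
  rintro y (rfl | hy)
  · exact hx
  · exact hF.notMem_of_gap hn hD hz hy

lemma add_mem_component {x y : ℝ × ℝ} (hy : y ∈ connectedComponentIn (periodicExtension F)ᶜ x)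
    (z : ℤ × ℤ) : y + latticePoint z ∈
      connectedComponentIn (periodicExtension F)ᶜ (x + latticePoint z) := by
  have hx : x ∈ (periodicExtension F)ᶜ := connectedComponentIn_nonempty_iff.1 ⟨y, hy⟩
  refine (isPreconnected_connectedComponentIn.image (fun y => y + latticePoint z)
    (by fun_prop)).subset_connectedComponentIn ⟨x, mem_connectedComponentIn hx, rfl⟩ ?_ ⟨y, hy, rfl⟩
  rintro _ ⟨w, hw, rfl⟩ h
  exact connectedComponentIn_subset _ _ hw ((add_latticePoint_mem z).1 h)

lemma smallCentre_add (hn : n ≠ 0) (r m : ℤ × ℤ) :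
    smallCentre n (r + (n * m.1, n * m.2)) = smallCentre n r + latticePoint m := by
  have hn' : (n : ℝ) ≠ 0 := by positivity
  ext <;> simp [smallCentre] <;> field_simp <;> ring

/-- There are finitely many centres modulo `ℤ²`. A component containing no two points that differ by
a nonzero integer vector contains at most one translate of each, so up to translation only finitely
many distances occur. -/
lemma exists_dist_smallCentre_le (hn : n ≠ 0)
    (hper : ∀ v : ℤ × ℤ, v ≠ 0 → ∀ x, x + latticePoint v ∉
      connectedComponentIn (periodicExtension F)ᶜ x) :
    ∃ R : ℝ, ∀ y z : ℤ × ℤ, smallCentre n z ∈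
      connectedComponentIn (periodicExtension F)ᶜ (smallCentre n y) →
      dist (smallCentre n z) (smallCentre n y) ≤ R := by
  set P : Set ((ℤ × ℤ) × (ℤ × ℤ)) := (Ico 0 (n : ℤ) ×ˢ Ico 0 (n : ℤ)) ×ˢ
    (Ico 0 (n : ℤ) ×ˢ Ico 0 (n : ℤ)) with hP
  have hPfin : P.Finite := ((finite_Ico _ _).prod (finite_Ico _ _)).prod
    ((finite_Ico _ _).prod (finite_Ico _ _))
  set S : (ℤ × ℤ) × (ℤ × ℤ) → Set ℝ := fun p =>
    (fun m => dist (smallCentre n p.2 + latticePoint m) (smallCentre n p.1)) ''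
      {m | smallCentre n p.2 + latticePoint m ∈
        connectedComponentIn (periodicExtension F)ᶜ (smallCentre n p.1)} with hS
  have hSfin : (⋃ p ∈ P, S p).Finite := by
    refine hPfin.biUnion fun p _ => Set.Finite.image _ (Set.Subsingleton.finite ?_)
    intro m hm m' hm'
    rw [mem_ofPred_eq] at hm hm'
    by_contra hne
    refine hper (m' - m) (sub_ne_zero.2 (Ne.symm hne)) (smallCentre n p.2 + latticePoint m) ?_
    rw [← connectedComponentIn_eq hm, latticePoint_sub]
    convert hm' using 1
    abel
  obtain ⟨R, hR⟩ := hSfin.bddAbove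
  refine ⟨R, fun y z h => hR ?_⟩
  have hn0 : (0 : ℤ) < n := by positivity
  let r : ℤ × ℤ → ℤ × ℤ := fun z => (z.1 % n, z.2 % n)
  let q : ℤ × ℤ → ℤ × ℤ := fun z => (z.1 / n, z.2 / n)
  have hrq : ∀ z, smallCentre n z = smallCentre n (r z) + latticePoint (q z) := fun z => by
    rw [← smallCentre_add hn]
    congr 1
    exact Prod.ext (Int.emod_add_mul_ediv _ _).symm (Int.emod_add_mul_ediv _ _).symm
  have hr : ∀ z, r z ∈ Ico 0 (n : ℤ) ×ˢ Ico 0 (n : ℤ) := fun z =>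
    ⟨⟨Int.emod_nonneg _ hn0.ne', Int.emod_lt_of_pos _ hn0⟩,
      ⟨Int.emod_nonneg _ hn0.ne', Int.emod_lt_of_pos _ hn0⟩⟩
  refine mem_biUnion (show (r y, r z) ∈ P from ⟨hr y, hr z⟩) ⟨q z - q y, ?_, ?_⟩
  · have := add_mem_component h (-q y)
    rw [hrq z, hrq y, latticePoint_neg, add_neg_cancel_right] at this
    rw [mem_ofPred_eq, latticePoint_sub]
    convert this using 1
    abel
  · simp only
    rw [hrq z, hrq y, latticePoint_sub, ← dist_add_right _ _ (latticePoint (q y))]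
    congr 1
    abel

lemma dist_smallCentre_le (hn : n ≠ 0) {x : ℝ × ℝ} {z : ℤ × ℤ}
    (hxz : (n : ℝ) • x ∈ closedCell z) : dist x (smallCentre n z) ≤ 1 := by
  have hn1 : (1 : ℝ) ≤ n := by exact_mod_cast Nat.one_le_iff_ne_zero.2 hn
  have key : ∀ a b : ℝ, b ≤ n * a → n * a ≤ b + 1 → |a - (n : ℝ)⁻¹ * (b + 2⁻¹)| ≤ 1 := by
    intro a b h1 h2
    have e : a - (n : ℝ)⁻¹ * (b + 2⁻¹) = (n * a - b - 2⁻¹) / n := by field_simp; ring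
    rw [e, abs_le, le_div_iff₀ (by positivity), div_le_iff₀ (by positivity)]
    constructor <;> linarith
  obtain ⟨⟨h1, h2⟩, h3, h4⟩ := hxz
  rw [Prod.dist_eq, max_le_iff, Real.dist_eq, Real.dist_eq]
  refine ⟨?_, ?_⟩
  · simpa [smallCentre, mul_add] using key x.1 z.1 h1 h2
  · simpa [smallCentre, mul_add] using key x.2 z.2 h3 h4

lemma IsFractalSquare.exists_dist_gap_le (hn : 2 ≤ n) (hD : ∀ d ∈ D, d.1 < n ∧ d.2 < n)
    (hF : IsFractalSquare n D F)
    (hper : ∀ v : ℤ × ℤ, v ≠ 0 → ∀ x, x + latticePoint v ∉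
      connectedComponentIn (periodicExtension F)ᶜ x) :
    ∃ R : ℝ, ∀ x ∈ gapSet n D, ∀ y ∈ gapSet n D,
      y ∈ connectedComponentIn (periodicExtension F)ᶜ x → dist x y ≤ R := by
  obtain ⟨R, hR⟩ := exists_dist_smallCentre_le (by omega : n ≠ 0) hper
  refine ⟨R + 2, ?_⟩
  rintro x ⟨z, hz, hxz⟩ y ⟨w, hw, hyw⟩ hxy
  have hx : x ∉ periodicExtension F := connectedComponentIn_nonempty_iff.1 ⟨y, hxy⟩
  have hy : y ∉ periodicExtension F := connectedComponentIn_subset _ _ hxy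
  have h1 := hF.smallCentre_mem_component hn hD hx hz hxz
  have h2 := hF.smallCentre_mem_component hn hD hy hw hyw
  rw [← connectedComponentIn_eq hxy, connectedComponentIn_eq h1] at h2
  have h3 := hR _ _ h2
  have h4 := dist_smallCentre_le (by omega) hxz
  have h5 := dist_smallCentre_le (by omega) hyw
  have h6 := dist_triangle4 x (smallCentre n z) (smallCentre n w) y
  rw [dist_comm (smallCentre n z), dist_comm (smallCentre n w) y] at h6
  linarith

/-- If the times at which a curve visits a closed set `B` correspond to points close to each other,
then a long part of the curve avoids `B`. -/
lemma exists_subinterval_avoiding {X : Type*} [PseudoMetricSpace X] {q : ℝ → X} (hq : Continuous q)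
    {B : Set X} (hB : IsClosed B) {s t R L : ℝ} (hst : s ≤ t) (hL : 0 ≤ L) (hR : 0 ≤ R)
    (hBR : ∀ a ∈ Icc s t, ∀ b ∈ Icc s t, q a ∈ B → q b ∈ B → dist (q a) (q b) ≤ R)
    (hlong : 2 * L + R + 2 ≤ dist (q s) (q t)) :
    ∃ s' t', s' ≤ t' ∧ Icc s' t' ⊆ Icc s t ∧ (∀ a ∈ Icc s' t', q a ∉ B) ∧
      L ≤ dist (q s') (q t') := by
  set T := Icc s t ∩ q ⁻¹' B with hT
  have hTc : IsCompact T := isCompact_Icc.inter_right (hB.preimage hq)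
  rcases T.eq_empty_or_nonempty with hTe | hTne
  · refine ⟨s, t, hst, Subset.rfl, fun a ha haB => ?_, by linarith⟩
    exact (hTe ▸ (⟨ha, haB⟩ : a ∈ T) : a ∈ (∅ : Set ℝ))
  obtain ⟨a, ⟨ha, haB⟩, hamin⟩ := hTc.exists_isLeast hTne
  obtain ⟨b, ⟨hb, hbB⟩, hbmax⟩ := hTc.exists_isGreatest hTne
  have hab := hBR a ha b hb haB hbB
  have htri := dist_triangle4 (q s) (q a) (q b) (q t)
  -- The first and last visits to `B` are at distance at most `R`, so one of the two outer arcs has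
  -- displacement at least `L + 1`. The spare 1 pays for stopping shortly before, or starting
  -- shortly after, the visit.
  by_cases h : L + 1 ≤ dist (q s) (q a)
  · have hsa : s < a := ha.1.lt_of_ne (fun h0 => by rw [h0, dist_self] at h; linarith)
    have hev : ∀ᶠ c in 𝓝[<] a, dist (q c) (q a) < 1 :=
      (hq.continuousAt.eventually (Metric.ball_mem_nhds _ one_pos)).filter_mono nhdsWithin_le_nhds
    obtain ⟨c, hc1, hc2, hc3⟩ := (hev.and (Ioo_mem_nhdsLT hsa)).exists
    refine ⟨s, c, hc2.le, Icc_subset_Icc_right (hc3.le.trans ha.2), fun u hu huB => ?_, ?_⟩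
    · have := hamin ⟨⟨hu.1, hu.2.trans (hc3.le.trans ha.2)⟩, huB⟩
      exact absurd (this.trans hu.2) (not_le.2 hc3)
    · have := dist_triangle (q s) (q c) (q a)
      linarith
  · have h' : L + 1 ≤ dist (q b) (q t) := by linarith
    have hbt : b < t := hb.2.lt_of_ne (fun h0 => by rw [h0, dist_self] at h'; linarith)
    have hev : ∀ᶠ c in 𝓝[>] b, dist (q c) (q b) < 1 :=
      (hq.continuousAt.eventually (Metric.ball_mem_nhds _ one_pos)).filter_mono nhdsWithin_le_nhds
    obtain ⟨c, hc1, hc2, hc3⟩ := (hev.and (Ioo_mem_nhdsGT hbt)).exists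
    refine ⟨c, t, hc3.le, Icc_subset_Icc_left (hb.1.trans hc2.le), fun u hu huB => ?_, ?_⟩
    · have := hbmax ⟨⟨(hb.1.trans hc2.le).trans hu.1, hu.2⟩, huB⟩
      exact absurd (hu.1.trans this) (not_le.2 hc2)
    · have := dist_triangle (q b) (q c) (q t)
      rw [dist_comm (q b) (q c)] at this
      linarith

/-- Since `n • x` avoids the gaps, its integer part is congruent to a digit `d`, and the fractional
part of `x` is the image of that of `n • x` under the contraction of `d`. Each level thus gains a
factor `1 / n`. -/
lemma IsFractalSquare.infDist_le (hn : 2 ≤ n) (hD : ∀ d ∈ D, d.1 < n ∧ d.2 < n)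
    (hF : IsFractalSquare n D F) (k : ℕ) : ∀ x : ℝ × ℝ,
      (∀ j, (n : ℝ) ^ j • x ∉ gapSet n D) →
      Metric.infDist (x - latticePoint (floorPoint x)) F ≤ (n : ℝ)⁻¹ ^ k := by
  have hn' : (n : ℝ) ≠ 0 := by positivity
  induction k with
  | zero =>
    intro x _
    obtain ⟨f, hf⟩ := hF.nonempty
    refine (Metric.infDist_le_dist_of_mem hf).trans ?_
    obtain ⟨⟨a1, a2⟩, a3, a4⟩ := hF.mem_unit hn hD hf
    obtain ⟨⟨b1, b2⟩, b3, b4⟩ := mem_closedCell_floorPoint x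
    rw [pow_zero, Prod.dist_eq, max_le_iff, Real.dist_eq, Real.dist_eq, abs_le, abs_le]
    refine ⟨⟨?_, ?_⟩, ?_, ?_⟩ <;> simp <;> linarith
  | succ k ih =>
    intro x hx
    have h1 := ih ((n : ℝ) • x) fun j => by
      rw [smul_smul, ← pow_succ]; exact hx (j + 1)
    obtain ⟨f, hf, hfd⟩ := hF.isCompact.exists_infDist_eq_dist hF.nonempty
      ((n : ℝ) • x - latticePoint (floorPoint ((n : ℝ) • x)))
    rw [hfd] at h1
    have hgap : ¬ IsGap n D (floorPoint ((n : ℝ) • x)) := fun h =>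
      hx 0 ⟨_, h, by simpa using mem_closedCell_floorPoint ((n : ℝ) • x)⟩
    unfold IsGap at hgap
    push Not at hgap
    obtain ⟨d, hd, w, hw⟩ := hgap
    have hfl : ∀ (a : ℝ) (c : ℕ) (m : ℤ), c < n → ⌊(n : ℝ) * a⌋ = n * m + c → ⌊a⌋ = m := by
      intro a c m hc h
      have hc' : (c : ℝ) + 1 ≤ n := by exact_mod_cast hc
      rw [Int.floor_eq_iff] at h ⊢
      push_cast at h
      have hn0 : (0 : ℝ) < n := by positivity
      have hc0 : (0 : ℝ) ≤ c := by positivity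
      constructor <;> nlinarith [h.1, h.2]
    have hw1 : floorPoint x = w := by
      have e1 := congrArg Prod.fst hw
      have e2 := congrArg Prod.snd hw
      exact Prod.ext (hfl _ _ _ (hD d hd).1 e1) (hfl _ _ _ (hD d hd).2 e2)
    refine (Metric.infDist_le_dist_of_mem (hF.contract_mem hf hd)).trans ?_
    have : x - latticePoint (floorPoint x) = (n : ℝ)⁻¹ •
        ((n : ℝ) • x - latticePoint (floorPoint ((n : ℝ) • x)) + ((d.1 : ℝ), (d.2 : ℝ))) := by
      rw [hw, hw1]
      ext <;> simp <;> field_simp <;> ring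
    rw [this, dist_smul₀, dist_add_right, pow_succ', Real.norm_of_nonneg (by positivity)]
    exact mul_le_mul_of_nonneg_left h1 (by positivity)

lemma IsFractalSquare.mem_of_forall_notMem_gapSet (hn : 2 ≤ n) (hD : ∀ d ∈ D, d.1 < n ∧ d.2 < n)
    (hF : IsFractalSquare n D F) {x : ℝ × ℝ} (hx : ∀ j, (n : ℝ) ^ j • x ∉ gapSet n D) :
    x ∈ periodicExtension F := by
  refine mem_periodicExtension.2 ⟨floorPoint x, ?_⟩
  rw [hF.isCompact.isClosed.mem_iff_infDist_zero hF.nonempty]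
  refine le_antisymm ?_ Metric.infDist_nonneg
  have hn1 : (1 : ℝ) < n := by exact_mod_cast hn
  exact ge_of_tendsto' (tendsto_pow_atTop_nhds_zero_of_lt_one (by positivity)
    (inv_lt_one_of_one_lt₀ hn1)) fun k => hF.infDist_le hn hD k x hx

/-- A long curve in the complement is alternately trimmed to avoid the gaps and expanded by `n`. The
nested time intervals share a time at which the curve avoids the gaps at every scale, so it meets
`H` there. -/
lemma IsFractalSquare.isBounded_component (hn : 3 ≤ n) (hD : ∀ d ∈ D, d.1 < n ∧ d.2 < n)
    (hF : IsFractalSquare n D F)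
    (hper : ∀ v : ℤ × ℤ, v ≠ 0 → ∀ x, x + latticePoint v ∉
      connectedComponentIn (periodicExtension F)ᶜ x) (x : ℝ × ℝ) :
    Bornology.IsBounded (connectedComponentIn (periodicExtension F)ᶜ x) := by
  have hn2 : 2 ≤ n := by omega
  obtain ⟨R₀, hR₀⟩ := hF.exists_dist_gap_le hn2 hD hper
  obtain ⟨R, hR, hRR⟩ : ∃ R, 0 ≤ R ∧ R₀ ≤ R := ⟨max R₀ 0, le_max_right _ _, le_max_left _ _⟩
  -- Then `3 * L = 2 * L + R + 2`, the length that trimming reduces to `L`; expansion by `n ≥ 3`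
  -- brings `L` back to at least `3 * L`.
  set L := R + 2 with hL
  refine Metric.isBounded_iff.2 ⟨3 * L, fun a ha b hb => ?_⟩
  by_contra! hab
  have hx : x ∈ (periodicExtension F)ᶜ := connectedComponentIn_nonempty_iff.1 ⟨a, ha⟩
  have hopen : IsOpen (connectedComponentIn (periodicExtension F)ᶜ x) :=
    (isClosed_periodicExtension hF.isCompact).isOpen_compl.connectedComponentIn
  have hpath := (hopen.isConnected_iff_isPathConnected.1
    ⟨⟨a, ha⟩, isPreconnected_connectedComponentIn⟩).joinedIn a ha b hb
  obtain ⟨γ, hγ⟩ := hpath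
  set p : ℝ → ℝ × ℝ := fun u => γ.extend u with hp
  have hpc : Continuous p := γ.extend.continuous
  have hpH : ∀ u, p u ∉ periodicExtension F := fun u =>
    connectedComponentIn_subset _ _ (hγ _)
  have trim : ∀ (k : ℕ) (s t : ℝ), s ≤ t →
      (∀ u ∈ Icc s t, (n : ℝ) ^ k • p u ∉ periodicExtension F) →
      3 * L ≤ dist ((n : ℝ) ^ k • p s) ((n : ℝ) ^ k • p t) →
      ∃ s' t', s' ≤ t' ∧ Icc s' t' ⊆ Icc s t ∧
        (∀ u ∈ Icc s' t', (n : ℝ) ^ k • p u ∉ gapSet n D) ∧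
        L ≤ dist ((n : ℝ) ^ k • p s') ((n : ℝ) ^ k • p t') := by
    intro k s t hst hH hlong
    refine exists_subinterval_avoiding (q := fun u => (n : ℝ) ^ k • p u) (R := R)
      (hpc.const_smul ((n : ℝ) ^ k)) (isClosed_gapSet n D) hst (by linarith) hR (fun c hc d hd hcB hdB => ?_)
      (by linarith)
    refine (hR₀ _ hcB _ hdB ?_).trans hRR
    refine (isPreconnected_Icc.image (fun u => (n : ℝ) ^ k • p u)
      (hpc.const_smul ((n : ℝ) ^ k)).continuousOn).subset_connectedComponentIn ⟨c, hc, rfl⟩ ?_ ⟨d, hd, rfl⟩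
    rintro _ ⟨u, hu, rfl⟩
    exact hH u hu
  let Good : ℕ → ℝ × ℝ → Prop := fun k J => J.1 ≤ J.2 ∧
    (∀ u ∈ Icc J.1 J.2, (n : ℝ) ^ k • p u ∉ periodicExtension F) ∧
    (∀ u ∈ Icc J.1 J.2, (n : ℝ) ^ k • p u ∉ gapSet n D) ∧
    L ≤ dist ((n : ℝ) ^ k • p J.1) ((n : ℝ) ^ k • p J.2)
  have h0 : ∃ J, Good 0 J := by
    obtain ⟨s, t, hst, -, h1, h2⟩ := trim 0 0 1 zero_le_one (fun u _ => by simpa using hpH u)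
      (by simpa [hp] using hab.le)
    exact ⟨(s, t), hst, fun u _ => by simpa using hpH u, h1, h2⟩
  have hstep : ∀ k J, Good k J → ∃ J', Good (k + 1) J' ∧ Icc J'.1 J'.2 ⊆ Icc J.1 J.2 := by
    rintro k J ⟨h1, h2, h3, h4⟩
    have hH : ∀ u ∈ Icc J.1 J.2, (n : ℝ) ^ (k + 1) • p u ∉ periodicExtension F := fun u hu => by
      rw [pow_succ', mul_smul]
      exact hF.smul_notMem hn2 hD (h2 u hu) (h3 u hu)
    obtain ⟨s, t, hst, hsub, h5, h6⟩ := trim (k + 1) J.1 J.2 h1 hH (by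
      rw [pow_succ', mul_smul, mul_smul, dist_smul₀, Real.norm_natCast]
      have hn3 : (3 : ℝ) ≤ n := by exact_mod_cast hn
      have hL0 : 0 ≤ L := by linarith
      exact mul_le_mul hn3 h4 hL0 (by positivity))
    exact ⟨(s, t), ⟨hst, fun u hu => hH u (hsub hu), h5, h6⟩, hsub⟩
  choose! next hnext hsub using hstep
  obtain ⟨J₀, hJ₀⟩ := h0
  let J : ℕ → ℝ × ℝ := fun k => Nat.rec J₀ (fun k J => next k J) k
  have hJ : ∀ k, Good k (J k) := fun k => by
    induction k with
    | zero => exact hJ₀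
    | succ k ih => exact hnext k _ ih
  obtain ⟨u, hu⟩ := IsCompact.nonempty_iInter_of_sequence_nonempty_isCompact_isClosed
    (fun k => Icc (J k).1 (J k).2) (fun k => hsub k _ (hJ k))
    (fun k => nonempty_Icc.2 (hJ k).1) isCompact_Icc (fun k => isClosed_Icc)
  rw [mem_iInter] at hu
  exact hpH u (hF.mem_of_forall_notMem_gapSet hn2 hD fun k => (hJ k).2.2.1 u (hu k))

/-- If `Hᶜ` has an unbounded component, then it contains a curve joining two points which differ by
a nonzero integer vector. -/
lemma IsFractalSquare.exists_loop (hn : 2 ≤ n) (hD : ∀ d ∈ D, d.1 < n ∧ d.2 < n)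
    (hF : IsFractalSquare n D F) {x : ℝ × ℝ}
    (hx : ¬ Bornology.IsBounded (connectedComponentIn (periodicExtension F)ᶜ x)) :
    ∃ v : ℤ × ℤ, v ≠ 0 ∧ ∃ γ : unitInterval → ℝ × ℝ, Continuous γ ∧
      γ 1 = γ 0 + latticePoint v ∧ ∀ t, γ t ∉ periodicExtension F := by
  -- The ratio `n ^ 2 ≥ 4` meets the requirement of ratio at least 3, also when `n = 2`.
  obtain ⟨D', hD', hF'⟩ := hF.sq (by omega) hD
  by_contra! hcon
  refine hx (hF'.isBounded_component (by nlinarith) hD' (fun v hv y hy => ?_) x)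
  have hyc : y ∈ (periodicExtension F)ᶜ := connectedComponentIn_nonempty_iff.1 ⟨_, hy⟩
  have hopen : IsOpen (connectedComponentIn (periodicExtension F)ᶜ y) :=
    (isClosed_periodicExtension hF.isCompact).isOpen_compl.connectedComponentIn
  obtain ⟨γ, hγ⟩ := (hopen.isConnected_iff_isPathConnected.1
    ⟨⟨_, hy⟩, isPreconnected_connectedComponentIn⟩).joinedIn y (mem_connectedComponentIn hyc) _ hy
  obtain ⟨t, ht⟩ := hcon v hv γ γ.continuous (by simp)
  exact connectedComponentIn_subset _ _ (hγ t) ht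

/-! ### A non-collinear continuum on the frontier of a bounded component. -/

/-- A connected subset of a line is convex. -/
lemma convex_of_cross_eq_zero {C : Set (ℝ × ℝ)} (hC : IsPreconnected C) {v : ℝ × ℝ} (hv : v ≠ 0)
    (h : ∀ x ∈ C, ∀ y ∈ C, cross v (x - y) = 0) : Convex ℝ C := by
  rcases C.eq_empty_or_nonempty with rfl | ⟨a, ha⟩
  · exact convex_empty
  let φ : ℝ × ℝ → ℝ := fun x => (x.1 - a.1) * v.1 + (x.2 - a.2) * v.2
  have hφ : Continuous φ := by fun_prop
  have hpos := sum_sq_pos hv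
  have hrec : ∀ x ∈ C, x = a + (φ x / (v.1 ^ 2 + v.2 ^ 2)) • v := fun x hx => by
    obtain ⟨t, ht⟩ := exists_smul_of_cross_eq_zero hv (h x hx a ha)
    have e1 : x.1 - a.1 = t * v.1 := congrArg Prod.fst ht
    have e2 : x.2 - a.2 = t * v.2 := congrArg Prod.snd ht
    have : φ x = t * (v.1 ^ 2 + v.2 ^ 2) := by simp only [φ, e1, e2]; ring
    rw [this, mul_div_cancel_right₀ _ hpos.ne', ← ht]
    abel
  have hconv : Convex ℝ (φ '' C) := (hC.image φ hφ.continuousOn).ordConnected.convex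
  intro x hx y hy s t hs ht hst
  obtain ⟨z, hz, hφz⟩ := hconv (mem_image_of_mem φ hx) (mem_image_of_mem φ hy) hs ht hst
  convert hz using 1
  conv_rhs => rw [hrec z hz, hφz]
  conv_lhs => rw [hrec x hx, hrec y hy]
  have : a = s • a + t • a := by rw [← add_smul, hst, one_smul]
  conv_rhs => rw [this]
  simp only [smul_add, smul_smul, smul_eq_mul, add_div, add_smul]
  rw [mul_div_assoc, mul_div_assoc]
  abel

lemma frontier_connectedComponentIn_subset_compl {S : Set (ℝ × ℝ)} (hS : IsOpen S) (x : ℝ × ℝ) :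
    frontier (connectedComponentIn S x) ⊆ Sᶜ := by
  intro y hy hyS
  have hopen : IsOpen (connectedComponentIn S y) := hS.connectedComponentIn
  obtain ⟨z, hz1, hz2⟩ := mem_closure_iff.1 (frontier_subset_closure hy) _ hopen
    (mem_connectedComponentIn hyS)
  have : connectedComponentIn S x = connectedComponentIn S y := by
    rw [connectedComponentIn_eq hz2, connectedComponentIn_eq hz1]
  rw [hS.connectedComponentIn.frontier_eq] at hy
  exact hy.2 (this ▸ mem_connectedComponentIn hyS)

lemma isClosed_connectedComponentIn {S : Set (ℝ × ℝ)} (hS : IsClosed S) (x : ℝ × ℝ) :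
    IsClosed (connectedComponentIn S x) := by
  by_cases hx : x ∈ S
  · rw [connectedComponentIn_eq_image hx]
    exact hS.isClosedEmbedding_subtypeVal.isClosedMap _ isClosed_connectedComponent
  · rw [connectedComponentIn_eq_empty hx]
    exact isClosed_empty

/-- The boundary of a bounded component of the complement of `F + ℤ²` contains a continuum which is
not contained in a line. -/
lemma exists_continuum_of_bounded_component (hF : IsCompact F) {p : ℝ × ℝ}
    (hp : p ∉ periodicExtension F)
    (hb : Bornology.IsBounded (connectedComponentIn (periodicExtension F)ᶜ p)) :
    ∃ E : Set (ℝ × ℝ), IsCompact E ∧ IsPreconnected E ∧ E ⊆ periodicExtension F ∧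
      ∀ v : ℝ × ℝ, v ≠ 0 → ∃ x ∈ E, ∃ y ∈ E, cross v (x - y) ≠ 0 := by
  have hopen := (isClosed_periodicExtension hF).isOpen_compl
  set U := connectedComponentIn (periodicExtension F)ᶜ p with hU
  have hpU : p ∈ U := mem_connectedComponentIn hp
  obtain ⟨x, hx, hfx⟩ := exists_frontier_component_not_subset_halfPlane hb hpU
  have hK : IsCompact (frontier U) :=
    Metric.isCompact_of_isClosed_isBounded isClosed_frontier
      (hb.closure.subset frontier_subset_closure)
  have hEK := connectedComponentIn_subset (frontier U) x
  have hEc : IsClosed (connectedComponentIn (frontier U) x) :=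
    isClosed_connectedComponentIn isClosed_frontier x
  refine ⟨connectedComponentIn (frontier U) x, hK.of_isClosed_subset hEc hEK,
    isPreconnected_connectedComponentIn, fun y hy => ?_, fun v hv => ?_⟩
  · simpa using frontier_connectedComponentIn_subset_compl hopen p (hEK hy)
  · by_contra! hcon
    have hconv := convex_of_cross_eq_zero isPreconnected_connectedComponentIn hv hcon
    have hpE : p ∉ connectedComponentIn (frontier U) x := fun h => by
      have h' := hEK h
      rw [hopen.connectedComponentIn.frontier_eq] at h'
      exact h'.2 hpU
    -- A collinear frontier component is closed, convex and misses `p`; separating it strictly from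
    -- `p` contradicts the choice of `x`.
    obtain ⟨f, u, hfu, hf⟩ := geometric_hahn_banach_point_closed hconv hEc hpE
    obtain ⟨y, hy, hy'⟩ := hfx f
    linarith [hf y hy]

/-! ### Linearity passes from `F` to continua in `F + ℤ²`. -/

/-- Parametrizations of the lines carrying the four edges of the unit square. -/
def edge (i : Bool × Bool) (s : ℝ) : ℝ × ℝ :=
  if i.1 then (s, if i.2 then 1 else 0) else (if i.2 then 1 else 0, s)

lemma edge_eq (i : Bool × Bool) (s : ℝ) :
    edge i s = edge i 0 + s • (edge i 1 - edge i 0) := by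
  rcases i with ⟨_ | _, _ | _⟩ <;> ext <;> simp [edge]

lemma exists_edge_of_notMem {x : ℝ × ℝ} (h1 : 0 ≤ x.1 ∧ x.1 ≤ 1) (h2 : 0 ≤ x.2 ∧ x.2 ≤ 1)
    (h : x ∉ openCell 0) : ∃ i s, x = edge i s := by
  by_contra! hcon
  apply h
  have a := hcon (false, false) x.2
  have b := hcon (false, true) x.2
  have c := hcon (true, false) x.1
  have d := hcon (true, true) x.1
  simp only [edge, Ne, Prod.ext_iff] at a b c d
  simp at a b c d
  refine ⟨⟨?_, ?_⟩, ?_, ?_⟩ <;> simp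
  · exact h1.1.lt_of_ne (Ne.symm a)
  · exact h1.2.lt_of_ne b
  · exact h2.1.lt_of_ne (Ne.symm c)
  · exact h2.2.lt_of_ne d

/-- On an edge parallel to `v` the function `cross v` is constant. On any other edge it is
injective, and an interval in the image would give a segment in `F` transversal to `v`. -/
lemma interior_cross_image_edge {v : ℝ × ℝ}
    (hlin : ∀ C : Set (ℝ × ℝ), IsPreconnected C → C ⊆ F → ∀ x ∈ C, ∀ y ∈ C, cross v (x - y) = 0)
    (i : Bool × Bool) : interior (cross v '' (F ∩ range (edge i))) = ∅ := by
  set u := edge i 1 - edge i 0 with hu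
  by_contra hne
  obtain ⟨c, hc⟩ := nonempty_iff_ne_empty.2 hne
  obtain ⟨ε, hε, hball⟩ := Metric.mem_nhds_iff.1 (mem_interior_iff_mem_nhds.1 hc)
  have hcr : ∀ s, cross v (edge i s) = cross v (edge i 0) + s * cross v u := fun s => by
    rw [edge_eq, cross_add, cross_smul]
  by_cases h0 : cross v u = 0
  · have : ∀ τ ∈ Metric.ball c ε, τ = cross v (edge i 0) := fun τ hτ => by
      obtain ⟨_, ⟨_, s, rfl⟩, rfl⟩ := hball hτ
      rw [hcr, h0, mul_zero, add_zero]
    have h1 := this c (Metric.mem_ball_self hε)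
    have h2 := this (c + ε / 2) (by simp [abs_of_pos hε, hε])
    linarith
  · let ψ : ℝ → ℝ × ℝ := fun τ => edge i ((τ - cross v (edge i 0)) / cross v u)
    have hψ : ContinuousOn ψ (Metric.ball c ε) := by
      have : ψ = fun τ => edge i 0 + ((τ - cross v (edge i 0)) / cross v u) • u := by
        funext τ; exact edge_eq _ _
      rw [this]
      fun_prop
    have hcψ : ∀ τ, cross v (ψ τ) = τ := fun τ => by
      change cross v (edge i _) = τ
      rw [hcr]; field_simp; ring
    have h := hlin (ψ '' Metric.ball c ε) ((convex_ball c ε).isPreconnected.image _ hψ) (by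
      rintro _ ⟨τ, hτ, rfl⟩
      obtain ⟨_, ⟨hsF, s, rfl⟩, rfl⟩ := hball hτ
      have : ψ (cross v (edge i s)) = edge i s := by
        simp only [ψ]; rw [hcr s]; congr 1; field_simp; ring
      rwa [this]) _ ⟨c, Metric.mem_ball_self hε, rfl⟩ _
      ⟨c + ε / 2, by simp [abs_of_pos hε, hε], rfl⟩
    rw [cross_sub, hcψ, hcψ] at h
    linarith

/-- If every connected subset of `F` is contained in a line of direction `v`, then so is every
continuum in `F + ℤ²`. -/
lemma IsFractalSquare.cross_eq_zero_of_continuum (hn : 2 ≤ n) (hD : ∀ d ∈ D, d.1 < n ∧ d.2 < n)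
    (hF : IsFractalSquare n D F) {v : ℝ × ℝ}
    (hlin : ∀ C : Set (ℝ × ℝ), IsPreconnected C → C ⊆ F → ∀ x ∈ C, ∀ y ∈ C, cross v (x - y) = 0)
    {E : Set (ℝ × ℝ)} (hEc : IsCompact E) (hE : IsPreconnected E) (hEH : E ⊆ periodicExtension F)
    {x y : ℝ × ℝ} (hx : x ∈ E) (hy : y ∈ E) : cross v (x - y) = 0 := by
  by_cases hcell : ∃ z, E ⊆ openCell z
  · obtain ⟨z, hz⟩ := hcell
    have := hlin ((fun x => x - latticePoint z) '' E) (hE.image _ (by fun_prop)) (by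
      rintro _ ⟨w, hw, rfl⟩
      exact hF.sub_mem_of_mem_openCell hn hD (hz hw) (hEH hw)) _ (mem_image_of_mem _ hx) _
      (mem_image_of_mem _ hy)
    simpa using this
  push Not at hcell
  -- The values of `cross v` at points of `H` on the cell borders: countably many closed sets with
  -- empty interior.
  let T : (ℤ × ℤ) × (Bool × Bool) → Set ℝ := fun p =>
    (fun τ => τ + cross v (latticePoint p.1)) '' (cross v '' (F ∩ range (edge p.2)))
  have hedge : ∀ w z, w - latticePoint z ∈ F → w - latticePoint z ∉ openCell 0 →
      cross v w ∈ ⋃ p, T p := by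
    intro w z hw hw'
    obtain ⟨h1, h2⟩ := hF.mem_unit hn hD hw
    obtain ⟨i, s, hs⟩ := exists_edge_of_notMem h1 h2 hw'
    refine mem_iUnion.2 ⟨(z, i), _, ⟨_, ⟨hw, s, hs.symm⟩, rfl⟩, ?_⟩
    simp only
    rw [← cross_add, sub_add_cancel]
  have hcover : cross v '' E ⊆ ⋃ p, T p := by
    rintro _ ⟨w, hw, rfl⟩
    obtain ⟨z, hz⟩ := mem_periodicExtension.1 (hEH hw)
    set K : Set (ℝ × ℝ) := E ∩ (fun x => x - latticePoint z) ⁻¹' F with hK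
    have hKc : IsCompact K := hEc.inter_right (hF.isCompact.isClosed.preimage (by fun_prop))
    have hwK : w ∈ K := ⟨hw, hz⟩
    have : CompactSpace K := isCompact_iff_compactSpace.1 hKc
    -- Boundary bumping: a component of `E ∩ (F + z)` inside the open cell would have a
    -- neighbourhood that is clopen in `E` and inside the cell, forcing all of `E` into it. As
    -- `cross v` is constant on the component, its value at `w` is attained on the border.
    have hbump : ∃ q ∈ connectedComponentIn K w, q ∉ openCell z := by
      by_contra! hcon
      obtain ⟨V, hV, hwV, hVO⟩ := exists_isClopen_subset (⟨w, hwK⟩ : K)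
        ((isOpen_openCell z).preimage continuous_subtype_val) (fun q hq => hcon q (by
          rw [connectedComponentIn_eq_image hwK]
          exact ⟨q, hq, rfl⟩))
      set P : Set (ℝ × ℝ) := Subtype.val '' V with hP
      have hPc : IsClosed P := (hV.isClosed.isCompact.image continuous_subtype_val).isClosed
      obtain ⟨O, hO, hOV⟩ := isOpen_induced_iff.1 hV.isOpen
      have hPO : ∀ q ∈ E, q ∈ O ∩ openCell z → q ∈ P := fun q hq hqO => by
        have hqK : q ∈ K := ⟨hq, hF.sub_mem_of_mem_openCell hn hD hqO.2 (hEH hq)⟩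
        exact ⟨⟨q, hqK⟩, hOV ▸ (show (⟨q, hqK⟩ : K) ∈ Subtype.val ⁻¹' O from hqO.1), rfl⟩
      have hPsub : P ⊆ O ∩ openCell z := by
        rintro _ ⟨q, hq, rfl⟩
        exact ⟨(hOV.symm ▸ hq : q ∈ Subtype.val ⁻¹' O), hVO hq⟩
      have hEO : E ⊆ O ∩ openCell z := by
        refine (isPreconnected_iff_subset_of_disjoint.1 hE _ _ (hO.inter (isOpen_openCell z))
          hPc.isOpen_compl (fun q hq => ?_) ?_).resolve_right fun h => h hw ⟨_, hwV, rfl⟩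
        · by_cases hqP : q ∈ P
          · exact Or.inl (hPsub hqP)
          · exact Or.inr hqP
        · rw [eq_empty_iff_forall_notMem]
          exact fun q hq => hq.2.2 (hPO q hq.1 hq.2.1)
      exact hcell z (hEO.trans inter_subset_right)
    obtain ⟨q, hq, hqz⟩ := hbump
    have hqK : q ∈ K := connectedComponentIn_subset _ _ hq
    have heq := hlin ((fun x => x - latticePoint z) '' connectedComponentIn K w)
      (isPreconnected_connectedComponentIn.image _ (by fun_prop)) (by
        rintro _ ⟨r, hr, rfl⟩
        exact (connectedComponentIn_subset _ _ hr).2) _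
      (mem_image_of_mem _ (mem_connectedComponentIn hwK)) _ (mem_image_of_mem _ hq)
    rw [sub_sub_sub_cancel_right, cross_sub, sub_eq_zero] at heq
    rw [heq]
    refine hedge q z hqK.2 fun h => hqz ?_
    obtain ⟨⟨a, b⟩, c, d⟩ := h
    simp at a b c d
    exact ⟨⟨by linarith, by linarith⟩, by linarith, by linarith⟩
  have hrange : ∀ i, range (edge i) = (fun p : ℝ × ℝ => if i.1 then p.2 else p.1) ⁻¹'
      {if i.2 then 1 else 0} := by
    rintro ⟨_ | _, _ | _⟩ <;> ext ⟨a, b⟩ <;> simp [edge, eq_comm]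
  have hTclosed : ∀ p, IsClosed (T p) := fun p => by
    have : IsClosed (range (edge p.2)) := by
      rw [hrange]
      refine isClosed_singleton.preimage ?_
      split_ifs <;> fun_prop
    exact (((hF.isCompact.inter_right this).image (continuous_cross v)).image
      (by fun_prop)).isClosed
  have hTint : ∀ p, interior (T p) = ∅ := fun p => by
    have := (Homeomorph.addRight (cross v (latticePoint p.1))).image_interior
      (cross v '' (F ∩ range (edge p.2)))
    rw [interior_cross_image_edge hlin, image_empty] at this
    exact this.symm
  -- By Baire the sets `T p` cannot cover an interval, so the connected set `cross v '' E` is a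
  -- single point.
  have hdense : Dense (⋂ p, (T p)ᶜ) :=
    dense_iInter_of_isOpen (fun p => (hTclosed p).isOpen_compl)
      (fun p => interior_eq_empty_iff_dense_compl.1 (hTint p))
  rw [cross_sub, sub_eq_zero]
  by_contra hne
  have hord := (hE.image (cross v) (continuous_cross v).continuousOn).ordConnected
  have hIcc := hord.uIcc_subset (mem_image_of_mem _ hx) (mem_image_of_mem _ hy)
  obtain ⟨τ, hτ1, hτ2⟩ := hdense.exists_mem_open isOpen_Ioo
    (nonempty_Ioo.2 (inf_lt_sup.2 hne) : (Ioo (cross v x ⊓ cross v y) (cross v x ⊔ cross v y)).Nonempty)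
  rw [← compl_iUnion] at hτ1
  exact hτ1 (hcover (hIcc (Ioo_subset_Icc_self hτ2)))

/-! ### Blowing up a segment to a line. -/

/-- If `F` contains a line segment, then `F + ℤ²` contains a parallel line. -/
lemma IsFractalSquare.exists_line (hn : 2 ≤ n) (hF : IsFractalSquare n D F) {a b : ℝ × ℝ}
    (hab : segment ℝ a b ⊆ F) : ∃ m : ℝ × ℝ, ∀ t : ℝ, m + t • (b - a) ∈ periodicExtension F := by
  set c := a + (1 / 2 : ℝ) • (b - a) with hc
  have hcell : IsCompact (closedCell 0) := isCompact_Icc.prod isCompact_Icc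
  -- The blown-up midpoints are brought back to the unit cell by integer translations, so a
  -- subsequence converges, while the segments around them become arbitrarily long.
  obtain ⟨m, -, φ, hφ, hlim⟩ := hcell.tendsto_subseq
    (x := fun k : ℕ => (n : ℝ) ^ k • c - latticePoint (floorPoint ((n : ℝ) ^ k • c))) fun k => by
      obtain ⟨⟨h1, h2⟩, h3, h4⟩ := mem_closedCell_floorPoint ((n : ℝ) ^ k • c)
      constructor <;> constructor <;> simp at * <;> linarith
  refine ⟨m, fun t => ?_⟩
  refine (isClosed_periodicExtension hF.isCompact).mem_of_tendsto
    (hlim.add_const (t • (b - a))) ?_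
  have hn1 : (1 : ℝ) < n := by exact_mod_cast hn
  have hev : ∀ᶠ k in atTop, 2 * |t| ≤ (n : ℝ) ^ φ k :=
    ((tendsto_pow_atTop_atTop_of_one_lt hn1).comp hφ.tendsto_atTop).eventually_ge_atTop _
  filter_upwards [hev] with k hk
  have hpos : (0 : ℝ) < (n : ℝ) ^ φ k := by positivity
  have hmem : a + (1 / 2 + t / (n : ℝ) ^ φ k) • (b - a) ∈ F := hab (by
    rw [segment_eq_image']
    refine ⟨_, ?_, rfl⟩
    have h1 : |t / (n : ℝ) ^ φ k| ≤ 1 / 2 := by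
      rw [abs_div, abs_of_pos hpos, div_le_iff₀ hpos]; linarith
    rw [abs_le] at h1
    constructor <;> linarith [h1.1, h1.2])
  have h2 := hF.pow_smul_mem (by omega) (φ k) (subset_periodicExtension F hmem)
  rw [← sub_latticePoint_mem (floorPoint ((n : ℝ) ^ φ k • c))] at h2
  convert h2 using 1
  have : (n : ℝ) ^ φ k • (a + (1 / 2 + t / (n : ℝ) ^ φ k) • (b - a)) =
      (n : ℝ) ^ φ k • c + t • (b - a) := by
    rw [add_smul, ← add_assoc, ← hc, smul_add, smul_smul, mul_div_cancel₀ _ hpos.ne']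
  rw [this, Function.comp_apply]
  abel

lemma IsFractalSquare.swap (hF : IsFractalSquare n D F) :
    IsFractalSquare n (D.image Prod.swap) (Prod.swap ⁻¹' F) := by
  refine ⟨?_, ?_, ?_⟩
  · rw [← image_swap_eq_preimage_swap]
    exact hF.isCompact.image continuous_swap
  · rw [← image_swap_eq_preimage_swap]
    exact hF.nonempty.image _
  · ext y
    rw [mem_preimage]
    conv_lhs => rw [hF.eq]
    constructor
    · rintro ⟨x, hx, d, hd, h⟩
      refine ⟨x.swap, by simpa using hx, d.swap, Finset.mem_image_of_mem _ hd, ?_⟩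
      rw [← Prod.swap_swap y, h]
      rfl
    · rintro ⟨x, hx, d, hd, rfl⟩
      obtain ⟨d', hd', rfl⟩ := Finset.mem_image.1 hd
      exact ⟨_, hx, d', hd', rfl⟩

lemma swap_digits (hD : ∀ d ∈ D, d.1 < n ∧ d.2 < n) :
    ∀ d ∈ D.image Prod.swap, d.1 < n ∧ d.2 < n := by
  intro d hd
  obtain ⟨d', hd', rfl⟩ := Finset.mem_image.1 hd
  exact (hD d' hd').symm

lemma swap_mem_periodicExtension {x : ℝ × ℝ} :
    x ∈ periodicExtension (Prod.swap ⁻¹' F) ↔ x.swap ∈ periodicExtension F := by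
  simp only [mem_periodicExtension]
  constructor
  · rintro ⟨z, hz⟩
    exact ⟨z.swap, hz⟩
  · rintro ⟨z, hz⟩
    exact ⟨z.swap, hz⟩

/-! ### From two crossing lines in `F + ℤ²` to a corner in `F`. -/

/-- `F` contains two non-parallel segments with a common endpoint. -/
def HasCorner (F : Set (ℝ × ℝ)) : Prop :=
  ∃ c x y, segment ℝ c x ⊆ F ∧ segment ℝ c y ⊆ F ∧ cross (x - c) (y - c) ≠ 0

/-- `F` contains a segment of direction `v` with endpoint `c`. -/
def HasStrand (F : Set (ℝ × ℝ)) (v c : ℝ × ℝ) : Prop :=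
  ∃ s : ℝ, s ≠ 0 ∧ segment ℝ c (c + s • v) ⊆ F

lemma HasStrand.hasCorner {v w c : ℝ × ℝ} (hv : HasStrand F v c) (hw : HasStrand F w c)
    (h : cross v w ≠ 0) : HasCorner F := by
  obtain ⟨s, hs, h1⟩ := hv
  obtain ⟨t, ht, h2⟩ := hw
  refine ⟨c, _, _, h1, h2, ?_⟩
  rw [add_sub_cancel_left, add_sub_cancel_left, cross_smul, cross_comm, cross_smul, cross_comm]
  simpa [hs, ht] using h

lemma segment_swap_subset {a b : ℝ × ℝ} (h : segment ℝ a b ⊆ Prod.swap ⁻¹' F) :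
    segment ℝ a.swap b.swap ⊆ F := by
  rintro _ ⟨s, t, hs, ht, hst, rfl⟩
  exact h ⟨s, t, hs, ht, hst, rfl⟩

lemma HasStrand.swap {v c : ℝ × ℝ} (h : HasStrand (Prod.swap ⁻¹' F) v c) :
    HasStrand F v.swap c.swap := by
  obtain ⟨s, hs, h⟩ := h
  exact ⟨s, hs, segment_swap_subset h⟩

lemma HasCorner.swap (h : HasCorner (Prod.swap ⁻¹' F)) : HasCorner F := by
  obtain ⟨c, x, y, h1, h2, h3⟩ := h
  refine ⟨c.swap, x.swap, y.swap, segment_swap_subset h1, segment_swap_subset h2, ?_⟩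
  simp only [cross, Prod.fst_sub, Prod.snd_sub, Prod.fst_swap, Prod.snd_swap] at h3 ⊢
  intro h
  apply h3
  linarith

/-- The half-line from `a` in direction `d` starts inside the interval `(k, k + 1)`. -/
def Enters (k : ℤ) (a d : ℝ) : Prop :=
  ((k : ℝ) < a ∧ a < k + 1) ∨ (a = k ∧ 0 < d) ∨ (a = k + 1 ∧ d < 0)

lemma Enters.eventually {k : ℤ} {a d : ℝ} (h : Enters k a d) :
    ∀ᶠ s : ℝ in 𝓝[>] 0, (k : ℝ) < a + s * d ∧ a + s * d < k + 1 := by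
  have hc : Tendsto (fun s : ℝ => a + s * d) (𝓝[>] 0) (𝓝 a) := by
    have : Continuous fun s : ℝ => a + s * d := by fun_prop
    have h := this.tendsto 0
    simp only [zero_mul, add_zero] at h
    exact h.mono_left nhdsWithin_le_nhds
  have hpos : ∀ᶠ s : ℝ in 𝓝[>] 0, 0 < s := self_mem_nhdsWithin
  rcases h with ⟨h1, h2⟩ | ⟨h1, h2⟩ | ⟨h1, h2⟩
  · exact (hc.eventually_const_lt h1).and (hc.eventually_lt_const h2)
  · filter_upwards [hpos, hc.eventually_lt_const (show a < k + 1 by linarith)] with s hs hs2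
    exact ⟨by rw [h1]; linarith [mul_pos hs h2], hs2⟩
  · filter_upwards [hpos, hc.eventually_const_lt (show (k : ℝ) < a by linarith)] with s hs hs2
    exact ⟨hs2, by rw [h1]; linarith [mul_neg_of_pos_of_neg hs h2]⟩

/-- An initial piece of the half-line runs inside the open cell `z`, where `H` coincides with `F +
z`; closedness adds the endpoint. The sign of `ρ` selects the half-line. -/
lemma IsFractalSquare.hasStrand_of_enters (hn : 2 ≤ n) (hD : ∀ d ∈ D, d.1 < n ∧ d.2 < n)
    (hF : IsFractalSquare n D F) {x v : ℝ × ℝ} (hx : ∀ t : ℝ, x + t • v ∈ periodicExtension F)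
    {z : ℤ × ℤ} {ρ : ℝ} (hρ : ρ ≠ 0) (h1 : Enters z.1 x.1 (ρ * v.1))
    (h2 : Enters z.2 x.2 (ρ * v.2)) : HasStrand F v (x - latticePoint z) := by
  obtain ⟨ε, hε, hs⟩ := mem_nhdsGT_iff_exists_Ioo_subset.1 (h1.eventually.and h2.eventually)
  have hε' : (0 : ℝ) < ε := hε
  refine ⟨ε * ρ, by positivity, ?_⟩
  rw [← closure_openSegment]
  refine closure_minimal ?_ hF.isCompact.isClosed
  rw [openSegment_eq_image']
  rintro _ ⟨θ, ⟨hθ0, hθ1⟩, rfl⟩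
  obtain ⟨⟨a1, a2⟩, a3, a4⟩ := hs (show θ * ε ∈ Ioo 0 ε from
    ⟨by positivity, by nlinarith⟩)
  have := hF.sub_mem_of_mem_openCell hn hD (x := x + (θ * (ε * ρ)) • v) (z := z)
    (by constructor <;> constructor <;> simp <;> linarith) (hx _)
  convert this using 1
  simp only
  rw [add_sub_cancel_left, smul_smul]
  abel

/-- The line through `x` in direction `v` does not consist of points with a fixed integer
coordinate. -/
def NonGrid (v x : ℝ × ℝ) : Prop :=
  (v.1 = 0 → ∀ k : ℤ, x.1 ≠ k) ∧ (v.2 = 0 → ∀ k : ℤ, x.2 ≠ k)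

lemma floor_lt_of_ne {a : ℝ} (h : ∀ k : ℤ, a ≠ k) : (⌊a⌋ : ℝ) < a ∧ a < ⌊a⌋ + 1 :=
  ⟨(Int.floor_le a).lt_of_ne (h _).symm, Int.lt_floor_add_one a⟩

lemma eq_floor_of_eq {a : ℝ} {k : ℤ} (h : a = k) : a = ⌊a⌋ := by
  rw [h, Int.floor_intCast]

/-- The endpoint of the strand does not depend on `v`, so two lines through `x` obtain strands in
one and the same cell. -/
lemma IsFractalSquare.hasStrand_of_nonGrid (hn : 2 ≤ n) (hD : ∀ d ∈ D, d.1 < n ∧ d.2 < n)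
    (hF : IsFractalSquare n D F) {x v : ℝ × ℝ} (hx : ∀ t : ℝ, x + t • v ∈ periodicExtension F)
    (hv : NonGrid v x) (hcorner : (∀ k : ℤ, x.1 ≠ k) ∨ ∀ k : ℤ, x.2 ≠ k) :
    HasStrand F v (x - latticePoint (floorPoint x)) := by
  by_cases h1 : ∀ k : ℤ, x.1 ≠ k
  · by_cases h2 : ∀ k : ℤ, x.2 ≠ k
    · exact hF.hasStrand_of_enters hn hD hx one_ne_zero (Or.inl (floor_lt_of_ne h1))
        (Or.inl (floor_lt_of_ne h2))
    · have hv2 : v.2 ≠ 0 := fun h => h2 (hv.2 h)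
      push Not at h2
      obtain ⟨k, hk⟩ := h2
      exact hF.hasStrand_of_enters hn hD hx hv2 (Or.inl (floor_lt_of_ne h1))
        (Or.inr (Or.inl ⟨eq_floor_of_eq hk, mul_self_pos.2 hv2⟩))
  · have h2 := hcorner.resolve_left h1
    have hv1 : v.1 ≠ 0 := fun h => h1 (hv.1 h)
    push Not at h1
    obtain ⟨k, hk⟩ := h1
    exact hF.hasStrand_of_enters hn hD hx hv1
      (Or.inr (Or.inl ⟨eq_floor_of_eq hk, mul_self_pos.2 hv1⟩)) (Or.inl (floor_lt_of_ne h2))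

/-- At a lattice point, lines with slopes of opposite sign enter no common cell. The crossing is
moved to the point `y` where the `v`-line meets the `w`-line shifted by `(1, 0)`: its abscissa lies
strictly between `k` and `k + 1`. -/
lemma IsFractalSquare.hasCorner_of_opposite (hn : 2 ≤ n) (hD : ∀ d ∈ D, d.1 < n ∧ d.2 < n)
    (hF : IsFractalSquare n D F) {x v w : ℝ × ℝ}
    (hv : ∀ t : ℝ, x + t • v ∈ periodicExtension F)
    (hw : ∀ t : ℝ, x + t • w ∈ periodicExtension F) {k : ℤ} (hk : x.1 = k)
    (hv12 : 0 < v.1 * v.2) (hw12 : w.1 * w.2 < 0) : HasCorner F := by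
  have hv1 := left_ne_zero_of_mul hv12.ne'
  have hv2 := right_ne_zero_of_mul hv12.ne'
  have hw1 := left_ne_zero_of_mul hw12.ne
  have hw2 := right_ne_zero_of_mul hw12.ne
  have hw0 : w ≠ 0 := fun h => hw1 (by rw [h]; rfl)
  have hAB : 0 < (v.1 * w.2) * (-(v.2 * w.1)) := by nlinarith
  set A := v.1 * w.2 with hA
  set B := -(v.2 * w.1) with hB
  have hcross : cross v w = A + B := by rw [cross, hA, hB]; ring
  have hsum : A + B ≠ 0 := fun h => by
    have : A = -B := by linarith
    rw [this] at hAB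
    nlinarith [sq_nonneg B]
  have hfrac : 0 < A / (A + B) ∧ A / (A + B) < 1 := by
    rcases pos_and_pos_or_neg_and_neg_of_mul_pos hAB with ⟨h1, h2⟩ | ⟨h1, h2⟩
    · exact ⟨div_pos h1 (by linarith), (div_lt_one (by linarith)).2 (by linarith)⟩
    · exact ⟨div_pos_of_neg_of_neg h1 (by linarith),
        (div_lt_one_of_neg (by linarith)).2 (by linarith)⟩
  set t := w.2 / (A + B) with ht
  set y := x + t • v with hy
  have hy1 : y.1 = k + A / (A + B) := by
    simp only [hy, Prod.fst_add, Prod.smul_fst, smul_eq_mul, hk, ht, hA]; ring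
  have hyint : ∀ j : ℤ, y.1 ≠ j := fun j h => by
    rw [hy1] at h
    have h3 : (k : ℝ) < j := by linarith [hfrac.1]
    have h4 : (j : ℝ) < ((k + 1 : ℤ) : ℝ) := by push_cast; linarith [hfrac.2]
    rw [Int.cast_lt] at h3 h4
    omega
  have hr : ∃ r : ℝ, y - (x + latticePoint (1, 0)) = r • w := by
    refine exists_smul_of_cross_eq_zero hw0 ?_
    simp only [cross, hy, ht, Prod.fst_sub, Prod.snd_sub, Prod.fst_add, Prod.snd_add, Prod.smul_fst,
      Prod.smul_snd, smul_eq_mul, latticePoint_fst, latticePoint_snd]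
    field_simp
    rw [hA, hB]
    push_cast
    ring
  obtain ⟨r, hr⟩ := hr
  have hcr : cross v w ≠ 0 := hcross ▸ hsum
  refine (hF.hasStrand_of_nonGrid hn hD (x := y) (v := v) (fun s => ?_)
    ⟨fun h => absurd h hv1, fun h => absurd h hv2⟩ (Or.inl hyint)).hasCorner
    (hF.hasStrand_of_nonGrid hn hD (x := y) (v := w) (fun s => ?_)
    ⟨fun h => absurd h hw1, fun h => absurd h hw2⟩ (Or.inl hyint)) hcr
  · rw [hy, add_assoc, ← add_smul]
    exact hv _
  · have : y + s • w = x + (r + s) • w + latticePoint (1, 0) := by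
      rw [add_smul, ← hr]; abel
    rw [this, add_latticePoint_mem]
    exact hw _

lemma IsFractalSquare.hasCorner_of_nonGrid (hn : 2 ≤ n) (hD : ∀ d ∈ D, d.1 < n ∧ d.2 < n)
    (hF : IsFractalSquare n D F) {x v w : ℝ × ℝ}
    (hv : ∀ t : ℝ, x + t • v ∈ periodicExtension F)
    (hw : ∀ t : ℝ, x + t • w ∈ periodicExtension F) (hvg : NonGrid v x) (hwg : NonGrid w x)
    (hvw : cross v w ≠ 0) : HasCorner F := by
  by_cases hcorner : (∀ k : ℤ, x.1 ≠ k) ∨ ∀ k : ℤ, x.2 ≠ k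
  · exact (hF.hasStrand_of_nonGrid hn hD hv hvg hcorner).hasCorner
      (hF.hasStrand_of_nonGrid hn hD hw hwg hcorner) hvw
  push Not at hcorner
  obtain ⟨⟨k, hk⟩, l, hl⟩ := hcorner
  have hv12 : v.1 * v.2 ≠ 0 := mul_ne_zero (fun h => hvg.1 h k hk) (fun h => hvg.2 h l hl)
  have hw12 : w.1 * w.2 ≠ 0 := mul_ne_zero (fun h => hwg.1 h k hk) (fun h => hwg.2 h l hl)
  have hpos : ∀ u : ℝ × ℝ, (∀ t : ℝ, x + t • u ∈ periodicExtension F) → 0 < u.1 * u.2 →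
      HasStrand F u (x - latticePoint (k, l)) := fun u hu h =>
    hF.hasStrand_of_enters hn hD hu (left_ne_zero_of_mul h.ne')
      (Or.inr (Or.inl ⟨hk, mul_self_pos.2 (left_ne_zero_of_mul h.ne')⟩))
      (Or.inr (Or.inl ⟨hl, h⟩))
  have hneg : ∀ u : ℝ × ℝ, (∀ t : ℝ, x + t • u ∈ periodicExtension F) → u.1 * u.2 < 0 →
      HasStrand F u (x - latticePoint (k - 1, l)) := fun u hu h =>
    hF.hasStrand_of_enters hn hD hu (right_ne_zero_of_mul h.ne)
      (Or.inr (Or.inr ⟨by simp [hk], by linarith⟩))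
      (Or.inr (Or.inl ⟨hl, mul_self_pos.2 (right_ne_zero_of_mul h.ne)⟩))
  -- At a lattice point, lines of positive slope both enter the upper right cell, and lines of
  -- negative slope the upper left one.
  rcases hv12.lt_or_gt with h1 | h1 <;> rcases hw12.lt_or_gt with h2 | h2
  · exact (hneg v hv h1).hasCorner (hneg w hw h2) hvw
  · exact hF.hasCorner_of_opposite hn hD hw hv hk h2 h1
  · exact hF.hasCorner_of_opposite hn hD hv hw hk h1 h2
  · exact (hpos v hv h1).hasCorner (hpos w hw h2) hvw

/-- If `F + ℤ²` contains a horizontal line of the grid, then `F` contains one of the horizontal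
edges of the unit square. -/
lemma IsFractalSquare.edge_subset (hn : 2 ≤ n) (hD : ∀ d ∈ D, d.1 < n ∧ d.2 < n)
    (hF : IsFractalSquare n D F) {k : ℤ} (hk : ∀ s : ℝ, (s, (k : ℝ)) ∈ periodicExtension F) :
    (∀ s ∈ Icc (0 : ℝ) 1, (s, (0 : ℝ)) ∈ F) ∨ ∀ s ∈ Icc (0 : ℝ) 1, (s, (1 : ℝ)) ∈ F := by
  have hor : ∀ s ∈ Ioo (0 : ℝ) 1, (s, (0 : ℝ)) ∈ F ∨ (s, (1 : ℝ)) ∈ F := by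
    intro s hs
    obtain ⟨z, hz⟩ := mem_periodicExtension.1 (hk s)
    obtain ⟨⟨h1, h2⟩, h3, h4⟩ := hF.mem_closedCell hn hD hz
    have e1 : (0 : ℤ) = z.1 :=
      eq_of_mem_cell (x := s) (by simpa using hs.1) (by simpa using hs.2) h1 h2
    simp only at h3 h4
    have h3' : z.2 ≤ k := by exact_mod_cast h3
    have h4' : k ≤ z.2 + 1 := by exact_mod_cast h4
    rcases (show z.2 = k ∨ z.2 = k - 1 by omega) with h | h
    · left; convert hz using 1; ext <;> simp [← e1, h]
    · right; convert hz using 1; ext <;> simp [← e1, h]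
  have hclos : ∀ j : ℝ, (∀ s ∈ Ioo (0 : ℝ) 1, (s, j) ∈ F) → ∀ s ∈ Icc (0 : ℝ) 1, (s, j) ∈ F := by
    intro j h s hs
    rw [← closure_Ioo zero_ne_one] at hs
    have hcl : IsClosed ((fun s : ℝ => (s, j)) ⁻¹' F) :=
      hF.isCompact.isClosed.preimage (by fun_prop)
    exact closure_minimal h hcl hs
  by_cases hbot : ∀ s ∈ Ioo (0 : ℝ) 1, (s, (0 : ℝ)) ∈ F
  · exact Or.inl (hclos 0 hbot)
  refine Or.inr (hclos 1 fun s hs => ?_)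
  push Not at hbot
  obtain ⟨s₀, hs₀, hs₀F⟩ := hbot
  have hopen : IsOpen (Ioo (0 : ℝ) 1 ∩ ((fun s : ℝ => (s, (0 : ℝ))) ⁻¹' F)ᶜ) :=
    isOpen_Ioo.inter (hF.isCompact.isClosed.preimage (by fun_prop)).isOpen_compl
  obtain ⟨ε, hε, hball⟩ := Metric.isOpen_iff.1 hopen s₀ ⟨hs₀, hs₀F⟩
  obtain ⟨j, hj⟩ := pow_unbounded_of_one_lt (1 / ε) (show (1 : ℝ) < n by exact_mod_cast hn)
  have hN : (0 : ℝ) < (n : ℝ) ^ j := by positivity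
  rw [div_lt_iff₀ hε] at hj
  -- With this `m` the point `(m + s) / n ^ j` is within `1 / n ^ j < ε` of `s₀`. There the bottom
  -- edge misses `F`, so the top edge belongs to `F`; expansion by `n ^ j` then reaches `s`.
  set m : ℤ := ⌊(n : ℝ) ^ j * s₀ - s⌋ + 1 with hm
  have hm1 : (n : ℝ) ^ j * s₀ - s < m := by rw [hm]; push_cast; exact Int.lt_floor_add_one _
  have hm2 : (m : ℝ) ≤ (n : ℝ) ^ j * s₀ - s + 1 := by
    rw [hm]; push_cast; linarith [Int.floor_le ((n : ℝ) ^ j * s₀ - s)]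
  set q := (m + s) / (n : ℝ) ^ j with hq
  have hqm : (n : ℝ) ^ j * q = m + s := by rw [hq]; field_simp
  have hqball : q ∈ Metric.ball s₀ ε := by
    rw [Metric.mem_ball, Real.dist_eq, abs_lt]
    constructor <;> nlinarith
  obtain ⟨hq01, hqF⟩ := hball hqball
  have hq1 : (q, (1 : ℝ)) ∈ F := (hor q hq01).resolve_left hqF
  obtain ⟨w, ⟨-, -⟩, ⟨-, hw2⟩, hw⟩ := hF.exists_digit_pow hn hD j hq1
  have hunit := hF.mem_unit hn hD hw
  simp only [Prod.fst_sub, Prod.smul_fst, smul_eq_mul, Prod.snd_sub, Prod.smul_snd, mul_one,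
    latticePoint_fst, latticePoint_snd, hqm] at hunit
  have e1 : m = w.1 := eq_of_mem_cell (x := m + s) (by linarith [hs.1]) (by linarith [hs.2])
    (by linarith [hunit.1.1]) (by linarith [hunit.1.2])
  -- At height 1 all vertical digits are maximal, so the expanded point lies again on the top edge.
  have e2 : (n : ℤ) ^ j ≤ w.2 + 1 := by
    have : (n : ℝ) ^ j ≤ w.2 + 1 := by linarith [hunit.2.2]
    exact_mod_cast this
  have e3 : (w.2 : ℝ) = (n : ℝ) ^ j - 1 := by
    have : w.2 = (n : ℤ) ^ j - 1 := by omega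
    rw [this]; push_cast; ring
  convert hw using 1
  ext
  · simp [hqm, ← e1]
  · simp [e3]

lemma hasStrand_of_edge {j : ℝ} (h : ∀ s ∈ Icc (0 : ℝ) 1, (s, j) ∈ F) {w : ℝ × ℝ} (hw1 : w.1 ≠ 0)
    (hw2 : w.2 = 0) {c : ℝ × ℝ} (hc1 : c.1 ∈ Icc (0 : ℝ) 1) (hc2 : c.2 = j) : HasStrand F w c := by
  obtain ⟨r, hr, hrc⟩ : ∃ r ∈ Icc (0 : ℝ) 1, r ≠ c.1 := by
    by_cases h0 : c.1 = 0
    · exact ⟨1, by simp, by simp [h0]⟩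
    · exact ⟨0, by simp, fun h => h0 h.symm⟩
  refine ⟨(r - c.1) / w.1, div_ne_zero (sub_ne_zero.2 hrc) hw1, ?_⟩
  rintro _ ⟨a, b, ha, hb, hab, rfl⟩
  have hmem := (convex_Icc (0 : ℝ) 1) hc1 hr ha hb hab
  convert h _ hmem using 1
  ext
  · simp only [Prod.fst_add, Prod.smul_fst, smul_eq_mul, div_mul_cancel₀ _ hw1]
    ring
  · simp only [Prod.snd_add, Prod.smul_snd, smul_eq_mul, hw2, hc2]
    linear_combination j * hab

/-- `F` contains a full horizontal edge of the unit square. If the other line is a vertical grid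
line, `F` also contains a vertical edge and the two meet at a vertex. Otherwise that line leaves the
grid line into the cell above (bottom edge in `F`) or below (top edge in `F`), giving a strand from
a point of the edge. -/
lemma IsFractalSquare.hasCorner_of_horizontal (hn : 2 ≤ n) (hD : ∀ d ∈ D, d.1 < n ∧ d.2 < n)
    (hF : IsFractalSquare n D F) {x v w : ℝ × ℝ}
    (hv : ∀ t : ℝ, x + t • v ∈ periodicExtension F)
    (hw : ∀ t : ℝ, x + t • w ∈ periodicExtension F) (hw2 : w.2 = 0) {k : ℤ} (hk : x.2 = k)
    (hvw : cross v w ≠ 0) : HasCorner F := by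
  have hw1 : w.1 ≠ 0 := fun h => hvw (by simp [cross, h, hw2])
  have hv2 : v.2 ≠ 0 := fun h => hvw (by simp [cross, h, hw2])
  have hline : ∀ s : ℝ, (s, (k : ℝ)) ∈ periodicExtension F := fun s => by
    convert hw ((s - x.1) / w.1) using 1
    ext
    · simp [hw1]
    · simp [hw2, hk]
  have hedge := hF.edge_subset hn hD hline
  by_cases hvg : v.1 = 0 ∧ ∃ l : ℤ, x.1 = l
  · obtain ⟨hv1, l, hl⟩ := hvg
    have hedge' := hF.swap.edge_subset hn (swap_digits hD) (k := l) fun s => by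
      rw [swap_mem_periodicExtension]
      convert hv ((s - x.2) / v.2) using 1
      ext
      · simp [hv1, hl]
      · simp [hv2]
    obtain ⟨j, hj01, hj⟩ : ∃ j ∈ Icc (0 : ℝ) 1, ∀ s ∈ Icc (0 : ℝ) 1, (s, j) ∈ F := by
      rcases hedge with h | h
      · exact ⟨0, by simp, h⟩
      · exact ⟨1, by simp, h⟩
    obtain ⟨i, hi01, hi⟩ : ∃ i ∈ Icc (0 : ℝ) 1, ∀ s ∈ Icc (0 : ℝ) 1,
        (s, i) ∈ Prod.swap ⁻¹' F := by
      rcases hedge' with h | h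
      · exact ⟨0, by simp, h⟩
      · exact ⟨1, by simp, h⟩
    have h1 := (hasStrand_of_edge hi (w := v.swap) hv2 hv1 (c := (j, i)) hj01 rfl).swap
    exact h1.hasCorner (hasStrand_of_edge hj hw1 hw2 (c := (i, j)) hi01 rfl) hvw
  have hmem : ∀ z : ℤ, (z : ℝ) ≤ x.1 → x.1 ≤ z + 1 → x.1 - z ∈ Icc (0 : ℝ) 1 := fun z h1 h2 =>
    ⟨by linarith, by linarith⟩
  have hx0 : x.1 - ⌊x.1⌋ ∈ Icc (0 : ℝ) 1 := hmem _ (Int.floor_le _) (Int.lt_floor_add_one _).le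
  have enter : ∀ ρ : ℝ, ρ ≠ 0 → ∃ z : ℤ, Enters z x.1 (ρ * v.1) ∧ x.1 - z ∈ Icc (0 : ℝ) 1 := by
    intro ρ hρ
    by_cases h1 : ∀ l : ℤ, x.1 ≠ l
    · exact ⟨⌊x.1⌋, Or.inl (floor_lt_of_ne h1), hx0⟩
    · push Not at h1
      obtain ⟨l, hl⟩ := h1
      have hv1 : v.1 ≠ 0 := fun h => hvg ⟨h, l, hl⟩
      rcases (mul_ne_zero hρ hv1).lt_or_gt with h | h
      · exact ⟨l - 1, Or.inr (Or.inr ⟨by simp [hl], h⟩), by simp [hl]⟩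
      · exact ⟨l, Or.inr (Or.inl ⟨hl, h⟩), by simp [hl]⟩
  rcases hedge with h | h
  · obtain ⟨z, hz, hz01⟩ := enter v.2 hv2
    refine (hF.hasStrand_of_enters hn hD hv (z := (z, k)) hv2 hz
      (Or.inr (Or.inl ⟨hk, mul_self_pos.2 hv2⟩))).hasCorner
      (hasStrand_of_edge h hw1 hw2 hz01 (by simp [hk])) hvw
  · obtain ⟨z, hz, hz01⟩ := enter (-v.2) (neg_ne_zero.2 hv2)
    refine (hF.hasStrand_of_enters hn hD hv (z := (z, k - 1)) (neg_ne_zero.2 hv2) hz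
      (Or.inr (Or.inr ⟨by simp [hk], ?_⟩))).hasCorner
      (hasStrand_of_edge h hw1 hw2 hz01 (by simp [hk])) hvw
    have : 0 < v.2 * v.2 := mul_self_pos.2 hv2
    linarith

lemma IsFractalSquare.hasCorner_of_not_nonGrid (hn : 2 ≤ n) (hD : ∀ d ∈ D, d.1 < n ∧ d.2 < n)
    (hF : IsFractalSquare n D F) {x v w : ℝ × ℝ}
    (hv : ∀ t : ℝ, x + t • v ∈ periodicExtension F)
    (hw : ∀ t : ℝ, x + t • w ∈ periodicExtension F) (hwg : ¬ NonGrid w x)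
    (hvw : cross v w ≠ 0) : HasCorner F := by
  unfold NonGrid at hwg
  rw [not_and_or] at hwg
  push Not at hwg
  rcases hwg with ⟨h, k, hk⟩ | ⟨h, k, hk⟩
  · refine (hF.swap.hasCorner_of_horizontal hn (swap_digits hD) (x := x.swap) (v := v.swap)
      (w := w.swap) (fun t => swap_mem_periodicExtension.2 (hv t))
      (fun t => swap_mem_periodicExtension.2 (hw t)) h hk ?_).swap
    intro h0
    apply hvw
    simp only [cross, Prod.fst_swap, Prod.snd_swap] at h0 ⊢
    linarith
  · exact hF.hasCorner_of_horizontal hn hD hv hw h hk hvw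

/-- If `F + ℤ²` contains two non-parallel lines, then `F` contains two non-parallel segments with a
common endpoint. -/
lemma IsFractalSquare.hasCorner_of_lines (hn : 2 ≤ n) (hD : ∀ d ∈ D, d.1 < n ∧ d.2 < n)
    (hF : IsFractalSquare n D F) {l m v w : ℝ × ℝ}
    (hv : ∀ t : ℝ, l + t • v ∈ periodicExtension F)
    (hw : ∀ t : ℝ, m + t • w ∈ periodicExtension F) (hvw : cross v w ≠ 0) : HasCorner F := by
  have hwv : cross w v ≠ 0 := by rw [cross_comm]; exact neg_ne_zero.2 hvw
  have hw0 : w ≠ 0 := fun h => hvw (by simp [h, cross])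
  set s := cross w (m - l) / cross w v with hs
  obtain ⟨t, ht⟩ := exists_smul_of_cross_eq_zero (v := w) (x := l + s • v - m) hw0 (by
    rw [cross_sub, cross_add, cross_smul, hs, div_mul_cancel₀ _ hwv, cross_sub]; ring)
  have hv' : ∀ r : ℝ, l + s • v + r • v ∈ periodicExtension F := fun r => by
    rw [add_assoc, ← add_smul]; exact hv _
  have hw' : ∀ r : ℝ, l + s • v + r • w ∈ periodicExtension F := fun r => by
    have : l + s • v + r • w = m + (t + r) • w := by rw [add_smul, ← ht]; abel
    rw [this]; exact hw _
  by_cases h1 : NonGrid w (l + s • v)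
  · by_cases h2 : NonGrid v (l + s • v)
    · exact hF.hasCorner_of_nonGrid hn hD hv' hw' h2 h1 hvw
    · exact hF.hasCorner_of_not_nonGrid hn hD hw' hv' h2 hwv
  · exact hF.hasCorner_of_not_nonGrid hn hD hv' hw' h1 hvw

/-! ### Components of `F`, and the two cases. -/

/-- All connected subsets of `F` are contained in lines of direction `v`. -/
def IsLinear (F : Set (ℝ × ℝ)) (v : ℝ × ℝ) : Prop :=
  ∀ C : Set (ℝ × ℝ), IsPreconnected C → C ⊆ F → ∀ x ∈ C, ∀ y ∈ C, cross v (x - y) = 0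

lemma IsFractalSquare.exists_isLinear (hn : 2 ≤ n) (hD : ∀ d ∈ D, d.1 < n ∧ d.2 < n)
    (hF : IsFractalSquare n D F) {U : Set (ℝ × ℝ)} (hU : IsComponent U (periodicExtension F)ᶜ)
    (hb : ¬ Bornology.IsBounded U) : ∃ v : ℝ × ℝ, v ≠ 0 ∧ IsLinear F v := by
  obtain ⟨x, -, rfl⟩ := hU
  obtain ⟨v, hv, γ, hγ, hγv, hγH⟩ := hF.exists_loop hn hD hb
  exact ⟨latticePoint v,
    fun h => hv (latticePoint_injective (by rw [h, latticePoint_zero])),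
    fun C hC hCF x hx y hy => hF.cross_eq_zero_of_loop hn hγ hv hγv hγH hC hCF hx hy⟩

lemma IsFractalSquare.not_isBounded_of_isLinear (hn : 2 ≤ n) (hD : ∀ d ∈ D, d.1 < n ∧ d.2 < n)
    (hF : IsFractalSquare n D F) {v : ℝ × ℝ} (hv : v ≠ 0) (hlin : IsLinear F v) {U : Set (ℝ × ℝ)}
    (hU : IsComponent U (periodicExtension F)ᶜ) : ¬ Bornology.IsBounded U := by
  obtain ⟨p, hp, rfl⟩ := hU
  intro hb
  obtain ⟨E, hEc, hE, hEH, hEv⟩ := exists_continuum_of_bounded_component hF.isCompact hp hb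
  obtain ⟨x, hx, y, hy, hxy⟩ := hEv v hv
  exact hxy (hF.cross_eq_zero_of_continuum hn hD hlin hEc hE hEH hx hy)

lemma exists_eq_segment {C : Set (ℝ × ℝ)} (hCc : IsCompact C) (hC : IsPreconnected C)
    (hCn : C.Nontrivial) {v : ℝ × ℝ} (hv : v ≠ 0) (h : ∀ x ∈ C, ∀ y ∈ C, cross v (x - y) = 0) :
    ∃ a : ℝ × ℝ, ∃ t : ℝ, 0 < t ∧ C = segment ℝ a (a + t • v) := by
  have hconv := convex_of_cross_eq_zero hC hv h
  have hpos := sum_sq_pos hv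
  let φ : ℝ × ℝ → ℝ := fun x => x.1 * v.1 + x.2 * v.2
  have hφ : Continuous φ := by fun_prop
  have hφadd : ∀ x (t : ℝ), φ (x + t • v) = φ x + t * (v.1 ^ 2 + v.2 ^ 2) := fun x t => by
    simp only [φ, Prod.fst_add, Prod.snd_add, Prod.smul_fst, Prod.smul_snd, smul_eq_mul]; ring
  obtain ⟨a, ha, hmin⟩ := hCc.exists_isMinOn hCn.nonempty hφ.continuousOn
  obtain ⟨b, hb, hmax⟩ := hCc.exists_isMaxOn hCn.nonempty hφ.continuousOn
  have hparam : ∀ x ∈ C, ∃ t : ℝ, 0 ≤ t ∧ x = a + t • v := fun x hx => by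
    obtain ⟨t, ht⟩ := exists_smul_of_cross_eq_zero hv (h x hx a ha)
    have hx' : x = a + t • v := by rw [← ht]; abel
    refine ⟨t, ?_, hx'⟩
    have h1 : φ a ≤ φ x := hmin hx
    rw [hx', hφadd] at h1
    exact nonneg_of_mul_nonneg_left (by linarith) hpos
  obtain ⟨t, ht, hbt⟩ := hparam b hb
  have hle : ∀ s : ℝ, a + s • v ∈ C → s ≤ t := fun s hs => by
    have h1 : φ (a + s • v) ≤ φ b := hmax hs
    rw [hbt, hφadd, hφadd] at h1
    exact le_of_mul_le_mul_right (by linarith) hpos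
  have htpos : 0 < t := by
    refine ht.lt_of_ne fun h0 => ?_
    obtain ⟨x, hx, hxa⟩ := hCn.exists_ne a
    obtain ⟨s, hs, rfl⟩ := hparam x hx
    have : s = 0 := le_antisymm (h0 ▸ hle s hx) hs
    exact hxa (by rw [this, zero_smul, add_zero])
  refine ⟨a, t, htpos, Subset.antisymm (fun x hx => ?_) (hbt ▸ hconv.segment_subset ha hb)⟩
  obtain ⟨s, hs, rfl⟩ := hparam x hx
  rw [segment_eq_image']
  refine ⟨s / t, ⟨by positivity, (div_le_one htpos).2 (hle s hx)⟩, ?_⟩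
  simp only [add_sub_cancel_left, smul_smul, div_mul_cancel₀ _ htpos.ne']

lemma IsLinear.exists_eq_segment (hF : IsCompact F) {v : ℝ × ℝ} (hv : v ≠ 0) (hlin : IsLinear F v)
    {C : Set (ℝ × ℝ)} (hC : IsComponent C F) (hCn : C.Nontrivial) :
    ∃ a : ℝ × ℝ, ∃ t : ℝ, 0 < t ∧ C = segment ℝ a (a + t • v) := by
  obtain ⟨x, hx, rfl⟩ := hC
  have hsub := connectedComponentIn_subset F x
  exact FractalSquare.exists_eq_segment
    (hF.of_isClosed_subset (isClosed_connectedComponentIn hF.isClosed x) hsub)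
    isPreconnected_connectedComponentIn hCn hv (hlin _ isPreconnected_connectedComponentIn hsub)

lemma cross_eq_zero_of_mem_segment {a b c x y : ℝ × ℝ} (hc : c ∈ segment ℝ a b)
    (hx : x ∈ segment ℝ a b) (hy : y ∈ segment ℝ a b) : cross (x - c) (y - c) = 0 := by
  rw [segment_eq_image'] at hc hx hy
  obtain ⟨r, -, rfl⟩ := hc
  obtain ⟨s, -, rfl⟩ := hx
  obtain ⟨t, -, rfl⟩ := hy
  simp [cross]
  ring

lemma HasCorner.exists_component (h : HasCorner F) :
    ∃ C, IsComponent C F ∧ C.Nontrivial ∧ ¬ IsLineSegment C := by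
  obtain ⟨c, x, y, hx, hy, hcross⟩ := h
  have hcF : c ∈ F := hx (left_mem_segment ℝ c x)
  have hx' := (convex_segment (𝕜 := ℝ) c x).isPreconnected.subset_connectedComponentIn
    (left_mem_segment ℝ c x) hx (right_mem_segment ℝ c x)
  have hy' := (convex_segment (𝕜 := ℝ) c y).isPreconnected.subset_connectedComponentIn
    (left_mem_segment ℝ c y) hy (right_mem_segment ℝ c y)
  refine ⟨_, ⟨c, hcF, rfl⟩, ⟨c, mem_connectedComponentIn hcF, x, hx', ?_⟩, ?_⟩
  · rintro rfl
    exact hcross (by simp [cross])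
  · rintro ⟨a, b, -, hab⟩
    have hc := mem_connectedComponentIn hcF
    rw [hab] at hx' hy' hc
    exact hcross (cross_eq_zero_of_mem_segment hc hx' hy')

/-- If all non-trivial components were segments, non-linearity would provide two non-parallel ones,
hence two lines in `H` and a corner in `F`. -/
lemma IsFractalSquare.exists_component_of_bounded (hn : 2 ≤ n)
    (hD : ∀ d ∈ D, d.1 < n ∧ d.2 < n) (hF : IsFractalSquare n D F) {U : Set (ℝ × ℝ)}
    (hU : IsComponent U (periodicExtension F)ᶜ) (hb : Bornology.IsBounded U) :
    ∃ C, IsComponent C F ∧ C.Nontrivial ∧ ¬ IsLineSegment C := by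
  by_contra hcon
  have hseg : ∀ C : Set (ℝ × ℝ), IsPreconnected C → C ⊆ F → ∀ x ∈ C, ∀ y ∈ C, x ≠ y →
      ∃ a b, segment ℝ a b ⊆ F ∧ x ∈ segment ℝ a b ∧ y ∈ segment ℝ a b := by
    intro C hC hCF x hx y hy hxy
    by_contra hno
    have hy' := hC.subset_connectedComponentIn hx hCF hy
    have hx' := mem_connectedComponentIn (hCF hx)
    refine hcon ⟨_, ⟨x, hCF hx, rfl⟩, ⟨x, hx', y, hy', hxy⟩, ?_⟩
    rintro ⟨a, b, -, hab⟩
    exact hno ⟨a, b, hab ▸ connectedComponentIn_subset F x, hab ▸ hx', hab ▸ hy'⟩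
  have hex : ∀ v : ℝ × ℝ, v ≠ 0 → ∃ a b, segment ℝ a b ⊆ F ∧ cross v (b - a) ≠ 0 := by
    intro v hv
    by_contra! hno
    refine hF.not_isBounded_of_isLinear hn hD hv (fun C hC hCF x hx y hy => ?_) hU hb
    by_cases hxy : x = y
    · simp [hxy, cross]
    obtain ⟨a, b, habF, hxab, hyab⟩ := hseg C hC hCF x hx y hy hxy
    rw [segment_eq_image'] at hxab hyab
    obtain ⟨s, -, rfl⟩ := hxab
    obtain ⟨t, -, rfl⟩ := hyab
    rw [add_sub_add_left_eq_sub, ← sub_smul, cross_smul, hno a b habF, mul_zero]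
  -- The direction `(1, 0)` is arbitrary; it only serves to produce one non-degenerate segment,
  -- whose direction is then used for the second.
  obtain ⟨a, b, hab, h1⟩ := hex (1, 0) (by simp)
  have hba : b - a ≠ 0 := fun h => h1 (by rw [h]; simp [cross])
  obtain ⟨c, d, hcd, h2⟩ := hex (b - a) hba
  obtain ⟨l, hl⟩ := hF.exists_line hn hab
  obtain ⟨m, hm⟩ := hF.exists_line hn hcd
  exact hcon (hF.hasCorner_of_lines hn hD hl hm h2).exists_component

/-- A line in `F + ℤ²` forces the complement to have infinitely many unbounded components as soon as
it has one. -/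
lemma infinite_unbounded_components {m d : ℝ × ℝ} (hd : d ≠ 0)
    (hm : ∀ t : ℝ, m + t • d ∈ periodicExtension F) {U : Set (ℝ × ℝ)}
    (hU : IsComponent U (periodicExtension F)ᶜ) (hb : ¬ Bornology.IsBounded U) :
    {U | IsComponent U (periodicExtension F)ᶜ ∧ ¬ Bornology.IsBounded U}.Infinite := by
  obtain ⟨x, hx, rfl⟩ := hU
  obtain ⟨z, hz⟩ := exists_lattice_cross_pos hd
  set δ := cross d (latticePoint z) with hδ
  -- The translates of the line by multiples of `z` are spaced by `δ` in the values of `cross d`; a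
  -- component varying by `δ` or more would meet one of them.
  have hstrip : ∀ y₁ ∈ connectedComponentIn (periodicExtension F)ᶜ x,
      ∀ y₂ ∈ connectedComponentIn (periodicExtension F)ᶜ x, cross d y₂ - cross d y₁ < δ := by
    intro y₁ h₁ y₂ h₂
    by_contra! hge
    obtain ⟨k, ⟨hk1, hk2⟩, -⟩ := existsUnique_add_zsmul_mem_Ico hz (cross d m) (cross d y₁)
    have hord := (isPreconnected_connectedComponentIn (F := (periodicExtension F)ᶜ) (x := x)).image
      (cross d) (continuous_cross d).continuousOn |>.ordConnected
    obtain ⟨y, hy, hyk⟩ := hord.out (mem_image_of_mem _ h₁) (mem_image_of_mem _ h₂)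
      ⟨hk1, by linarith⟩
    obtain ⟨t, ht⟩ := exists_smul_of_cross_eq_zero hd (x := y - (m + latticePoint (k • z))) (by
      rw [cross_sub, cross_add, hyk, latticePoint_zsmul, cross_smul, zsmul_eq_mul, sub_self])
    refine connectedComponentIn_subset _ _ hy ?_
    have : y = m + t • d + latticePoint (k • z) := by rw [← ht]; abel
    rw [this, add_latticePoint_mem]
    exact hm t
  refine Set.infinite_of_injective_forall_mem (f := fun j : ℤ =>
    connectedComponentIn (periodicExtension F)ᶜ (x + latticePoint (j • z))) ?_ fun j =>
    ⟨⟨_, fun h => hx ((add_latticePoint_mem _).1 h), rfl⟩, fun hbj => hb ?_⟩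
  · have key : ∀ i j : ℤ, connectedComponentIn (periodicExtension F)ᶜ (x + latticePoint (i • z)) =
        connectedComponentIn (periodicExtension F)ᶜ (x + latticePoint (j • z)) → i ≤ j := by
      intro i j hij
      have hmem : x + latticePoint (i • z) ∈
          connectedComponentIn (periodicExtension F)ᶜ (x + latticePoint (j • z)) :=
        hij ▸ mem_connectedComponentIn fun h => hx ((add_latticePoint_mem _).1 h)
      have h1 := add_mem_component hmem (-(j • z))
      rw [latticePoint_neg, add_neg_cancel_right] at h1
      have h2 := hstrip x (mem_connectedComponentIn hx) _ h1
      rw [← sub_eq_add_neg, cross_sub, cross_add, latticePoint_zsmul, latticePoint_zsmul,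
        cross_smul, cross_smul, ← hδ] at h2
      have h3 : (i : ℝ) < ((j + 1 : ℤ) : ℝ) := by
        push_cast
        by_contra! h4
        nlinarith
      rw [Int.cast_lt] at h3
      omega
    exact fun i j hij => le_antisymm (key i j hij) (key j i hij.symm)
  · obtain ⟨C, hC⟩ := Metric.isBounded_iff.1 hbj
    refine Metric.isBounded_iff.2 ⟨C, fun y₁ h₁ y₂ h₂ => ?_⟩
    rw [← dist_add_right _ _ (latticePoint (j • z))]
    exact hC (add_mem_component h₁ _) (add_mem_component h₂ _)

end FractalSquare

theorem theorem1p1 (n : ℕ) (hn : 2 ≤ n) (D : Finset (ℕ × ℕ))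
    (hD : ∀ d ∈ D, d.1 < n ∧ d.2 < n) (hD_one : 1 < D.card) (hD_lt : D.card < n ^ 2)
    (F : Set (ℝ × ℝ)) (hF : FractalSquare.IsFractalSquare n D F) :
    -- exactly one of the two cases occurs
    Xor
      (∃ U, FractalSquare.IsComponent U (FractalSquare.periodicExtension F)ᶜ ∧
        Bornology.IsBounded U)
      (∃ U, FractalSquare.IsComponent U (FractalSquare.periodicExtension F)ᶜ ∧
        ¬ Bornology.IsBounded U) ∧
    -- characterization of the bounded case
    ((∃ U, FractalSquare.IsComponent U (FractalSquare.periodicExtension F)ᶜ ∧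
        Bornology.IsBounded U) ↔
      ∃ C, FractalSquare.IsComponent C F ∧ C.Nontrivial ∧ ¬ FractalSquare.IsLineSegment C) ∧
    -- the unbounded case
    ((∃ U, FractalSquare.IsComponent U (FractalSquare.periodicExtension F)ᶜ ∧
        ¬ Bornology.IsBounded U) →
      IsTotallyDisconnected F ∨
        ((∃ C, FractalSquare.IsComponent C F ∧ C.Nontrivial) ∧
          FractalSquare.NontrivialComponentsParallelSegments F ∧
          {U | FractalSquare.IsComponent U (FractalSquare.periodicExtension F)ᶜ ∧
            ¬ Bornology.IsBounded U}.Infinite)) := by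
  open FractalSquare in
  have hnotboth : (∃ U, IsComponent U (periodicExtension F)ᶜ ∧ ¬ Bornology.IsBounded U) →
      ¬ ∃ U, IsComponent U (periodicExtension F)ᶜ ∧ Bornology.IsBounded U := by
    rintro ⟨U, hU, hb⟩ ⟨W, hW, hb'⟩
    obtain ⟨v, hv, hlin⟩ := hF.exists_isLinear hn hD hU hb
    exact hF.not_isBounded_of_isLinear hn hD hv hlin hW hb'
  obtain ⟨x, hx⟩ := hF.compl_nonempty hn hD hD_lt
  refine ⟨?_, ⟨?_, ?_⟩, ?_⟩
  · by_cases hb : Bornology.IsBounded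
      (connectedComponentIn (FractalSquare.periodicExtension F)ᶜ x)
    · exact Or.inl ⟨⟨_, ⟨x, hx, rfl⟩, hb⟩, fun h => hnotboth h ⟨_, ⟨x, hx, rfl⟩, hb⟩⟩
    · exact Or.inr ⟨⟨_, ⟨x, hx, rfl⟩, hb⟩, hnotboth ⟨_, ⟨x, hx, rfl⟩, hb⟩⟩
  · rintro ⟨U, hU, hb⟩
    exact hF.exists_component_of_bounded hn hD hU hb
  · rintro ⟨C, hC, hCn, hCs⟩
    refine ⟨_, ⟨x, hx, rfl⟩, ?_⟩
    -- An unbounded component would make `F` linear, and then `C` would be a segment.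
    by_contra hb
    obtain ⟨v, hv, hlin⟩ := hF.exists_isLinear hn hD ⟨x, hx, rfl⟩ hb
    obtain ⟨a, t, ht, rfl⟩ := hlin.exists_eq_segment hF.isCompact hv hC hCn
    exact hCs ⟨a, a + t • v, by simp [ht.ne', hv], rfl⟩
  · rintro ⟨U, hU, hb⟩
    obtain ⟨v, hv, hlin⟩ := hF.exists_isLinear hn hD hU hb
    by_cases hex : ∃ C, FractalSquare.IsComponent C F ∧ C.Nontrivial
    · refine Or.inr ⟨hex, ⟨v, hv, fun C hC hCn => hlin.exists_eq_segment hF.isCompact hv hC hCn⟩, ?_⟩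
      obtain ⟨C, hC, hCn⟩ := hex
      obtain ⟨a, t, ht, hCs⟩ := hlin.exists_eq_segment hF.isCompact hv hC hCn
      obtain ⟨y, hy, rfl⟩ := hC
      obtain ⟨m, hm⟩ := hF.exists_line hn (hCs ▸ connectedComponentIn_subset F y)
      rw [add_sub_cancel_left] at hm
      exact FractalSquare.infinite_unbounded_components (smul_ne_zero ht.ne' hv) hm hU hb
    · refine Or.inl fun C hCF hC a ha b hb => ?_
      by_contra hab
      exact hex ⟨_, ⟨a, hCF ha, rfl⟩, a, mem_connectedComponentIn (hCF ha), b,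
        hC.subset_connectedComponentIn ha hCF hb, hab⟩
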